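/- **Setting.** Let $x,y,z,w$ be four oriented edges of the $r$-petaled rose $\Gamma$ lying on four distinct petals (so $r\ge 4$); $\bar e$ denotes $e$ with the opposite orientation, and an oriented edge also denotes its initial direction at the vertex. For oriented edges $u,a$ on distinct petals, the *fold* $u\mapsto au$ is the self-map of the rose sending $u$ to the edge path $au$ (linearly on each half of $u$) and fixing all other petals; thus $y\mapsto y\bar w$ is the fold $\bar y\mapsto w\bar y$. An *ltt structure* $G$ based at the rose has the $2r$ directions as vertices, each red or purple, a black edge joining $d$ to $\bar d$ for each $d$, and a simple graph of colored edges on the vertices. A colored edge is purple if both ends are purple and red otherwise; $\mathcal{PI}(G)$ is the purple subgraph. It is of *type* $(r;\frac32-r)$ if there are exactly one red vertex and exactly one red edge and $\mathcal{PI}(G)$ is connected, and *admissible* if some bi-infinite path alternating between black and colored edges traverses every edge infinitely often toward each end. A *generating triple* $(g_k,G_{k-1},G_k)$ consists of a fold $g_k\colon u\mapsto au$ and type $(r;\frac32-r)$ ltt structures such that $[u,\bar a]$ is the red edge of $G_k$ ($u$ being its red vertex) and the direction map $Dg_k$ sends colored edges of $G_{k-1}$ to colored edges of $G_k$ and restricts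 to an isomorphism $\mathcal{PI}(G_{k-1})\to\mathcal{PI}(G_k)$. It is an *extension* (respectively a *switch*) if the red vertex of $G_{k-1}$ is $u$ (respectively $a$) and, $[u,l]$ (respectively $[a,l]$) being its red edge, $[a,l]$ is a purple edge of $G_k$. An *admissible composition* $(g_1,\dots,g_k;G_0,\dots,G_k)$ is one in which every $(g_i,G_{i-1},G_i)$ is an extension or a switch and every $G_i$ is an admissible type $(r;\frac32-r)$ ltt structure. An *ideally decomposed representative* $(g_1',\dots,g_n';G_0',\dots,G_n')$ is a sequence of folds of the $r$-petaled rose such that $g=g_n'\circ\dots\circ g_1'$ is a train track (every $g^k(e)$ is an immersed edge path), its transition matrix is irreducible, and $Dg$ fixes every direction other than that of the edge folded by $g_n'$. Here $G_j'=G(f_j)$ for $f_j=g_j'\circ\dots\circ g_1'\circ g_n'\circ\dots\circ g_{j+1}'$: its purple vertices are the directions periodic under $Df_j$ and its colored edges are the turns taken by the paths $f_j^k(e)$. A *periodic Nielsen path* of $g$ is a path $\rho$ in $\Gamma$ (with arbitrary endpoints), not homotopic rel endpoints to a constant path, such that $g^k(\rho)\simeq\rho$ rel endpoints for some $k\ge1$.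 A *Nielsen path prevention sequence* is an admissible composition $(g_1,\dots,g_k;G_0,\dots,G_k)$ such that no ideally decomposed representative $(g_1',\dots,g_{k+m}';G_0',\dots,G_{k+m}')$ has a periodic Nielsen path if its triples $(g_i';G_{i-1}',G_i')$, $1\le i\le k$, agree with $(g_i;G_{i-1},G_i)$ up to a common relabeling of the oriented edges that commutes with $e\mapsto\bar e$. **Lemma.** Let $G_0,\dots,G_6$ be the ltt structures with a single red vertex and a single red edge whose purple subgraphs $\mathcal{PI}(G_i)$ are the complete graphs on the remaining $2r-1$ vertices, with red edges (red vertex first) $$e^R_0=[x,y],\quad e^R_1=[z,\bar x],\quad e^R_2=[w,\bar z],\quad e^R_3=[\bar y,\bar w],\quad e^R_4=[\bar y,\bar x],\quad e^R_5=[\bar y,\bar w],\quad e^R_6=[\bar y,\bar x].$$ Then $$G_0\xrightarrow{g_1:\,z\mapsto xz}G_1\xrightarrow{g_2:\,w\mapsto zw}G_2\xrightarrow{g_3:\,y\mapsto y\bar w}G_3\xrightarrow{g_4:\,y\mapsto y\bar x}G_4\xrightarrow{g_5:\,y\mapsto y\bar w}G_5\xrightarrow{g_6:\,y\mapsto y\bar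 x}G_6$$ is a Nielsen path prevention sequence. -/

import Mathlib

/-! ### Roses, oriented edges and edge paths -/

/-- The oriented edges of the edge-indexed `r`-petaled rose: `(i, true)` is the edge `E_i` and
`(i, false)` is the same edge with the opposite orientation. An oriented edge is identified with
its initial direction at the vertex, so this is also the set of directions (and a rank-`r` edge
pair labeling set). -/
abbrev Dir (r : ℕ) : Type := Fin r × Bool

/-- The same edge with the opposite orientation. -/
def Dir.bar {r : ℕ} (d : Dir r) : Dir r := (d.1, !d.2)

/-- The identifications that build the `r`-petaled rose out of a point and `r` unit intervals:
both ends of each interval are glued to the point. -/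
inductive RoseRel (r : ℕ) :
    Unit ⊕ (Σ _ : Fin r, unitInterval) → Unit ⊕ (Σ _ : Fin r, unitInterval) → Prop
  | start (i : Fin r) : RoseRel r (Sum.inr ⟨i, 0⟩) (Sum.inl ())
  | finish (i : Fin r) : RoseRel r (Sum.inr ⟨i, 1⟩) (Sum.inl ())

/-- The `r`-petaled rose, as a topological space. -/
def Rose (r : ℕ) : Type := Quot (RoseRel r)

instance instTopologicalSpaceRose (r : ℕ) : TopologicalSpace (Rose r) :=
  inferInstanceAs (TopologicalSpace (Quot (RoseRel r)))

/-- The vertex of the rose. -/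
def Rose.vertex (r : ℕ) : Rose r := Quot.mk (RoseRel r) (Sum.inl ())

/-- The loop that runs once along the `i`-th petal. -/
def Rose.petal {r : ℕ} (i : Fin r) : Path (Rose.vertex r) (Rose.vertex r) where
  toFun t := Quot.mk (RoseRel r) (Sum.inr ⟨i, t⟩)
  continuous_toFun := by
    exact continuous_quot_mk.comp (continuous_inr.comp continuous_sigmaMk)
  source' := Quot.sound (RoseRel.start i)
  target' := Quot.sound (RoseRel.finish i)

/-- The loop along an oriented edge. -/
def Rose.edgePath {r : ℕ} (d : Dir r) : Path (Rose.vertex r) (Rose.vertex r) :=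
  if d.2 then Rose.petal d.1 else (Rose.petal d.1).symm

/-- The loop along an edge path (a finite sequence of oriented edges). -/
noncomputable def Rose.wordPath {r : ℕ} : List (Dir r) → Path (Rose.vertex r) (Rose.vertex r)
  | [] => Path.refl _
  | [d] => Rose.edgePath d
  | d :: e :: w => (Rose.edgePath d).trans (Rose.wordPath (e :: w))

/-- The continuous self-map of the rose that fixes the vertex and maps the `i`-th petal by the
loop `γ i`. -/
def Rose.mapOfLoops {r : ℕ} (γ : Fin r → Path (Rose.vertex r) (Rose.vertex r)) :
    C(Rose r, Rose r) where
  toFun := Quot.lift (Sum.elim (fun _ => Rose.vertex r) (fun p => γ p.1 p.2)) (by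
    rintro _ _ (i | i)
    · exact (γ i).source
    · exact (γ i).target)
  continuous_toFun := by
    apply continuous_quot_lift
    refine continuous_sum_dom.2 ⟨continuous_const, ?_⟩
    exact continuous_sigma fun i => (γ i).continuous

/-! ### Edge maps, turns and train tracks -/

/-- A map of roses on the level of edge paths: each oriented edge is sent to an edge path. -/
abbrev EdgeMap (r : ℕ) : Type := Dir r → List (Dir r)

/-- The image `W^k(d)` of an oriented edge under the `k`-th iterate, as an edge path (no
tightening). -/
def EdgeMap.iter {r : ℕ} (W : EdgeMap r) (k : ℕ) (d : Dir r) : List (Dir r) :=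
  (fun w => w.flatMap W)^[k] [d]

/-- The direction map: a direction goes to the first edge of its image. -/
def EdgeMap.dir {r : ℕ} (W : EdgeMap r) (d : Dir r) : Dir r := (W d).headD d

/-- A direction is periodic if some positive power of the direction map fixes it. -/
def EdgeMap.IsPeriodic {r : ℕ} (W : EdgeMap r) (d : Dir r) : Prop :=
  ∃ k : ℕ, 0 < k ∧ W.dir^[k] d = d

/-- An edge path `… e e' …` traverses (takes) the turn `{bar e, e'}`. -/
def TakesTurn {r : ℕ} (w : List (Dir r)) (d d' : Dir r) : Prop :=
  ∃ e e' : Dir r, [e, e'] <:+: w ∧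
    ((e.bar = d ∧ e' = d') ∨ (e.bar = d' ∧ e' = d))

/-- Train track: the image of each edge under each iterate is an immersed edge path, i.e. it never
traverses an edge and then immediately the same edge backwards. -/
def EdgeMap.IsTrainTrack {r : ℕ} (W : EdgeMap r) : Prop :=
  ∀ (d : Dir r) (k : ℕ), (W.iter k d).IsChain (fun e e' => e' ≠ e.bar)

/-- The transition matrix: the `(i, j)` entry is the number of times the image of `E_j` traverses
`E_i` in either direction. -/
def EdgeMap.transitionMatrix {r : ℕ} (W : EdgeMap r) : Matrix (Fin r) (Fin r) ℤ :=
  fun i j => ((W (j, true)).countP (fun d => d.1 = i) : ℕ)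

/-! ### Lamination train track structures -/

/-- An (indexed pair-labeled) lamination train track structure based at the `r`-petaled rose. The
vertices are the directions; vertices outside `red` are purple. `colored` is the graph of colored
edges: such an edge is purple if both its ends are purple and red otherwise. The black edges are
the edges joining `d` to `d.bar`; being determined, they are not recorded. -/
@[ext] structure LTT (r : ℕ) where
  red : Set (Dir r)
  colored : SimpleGraph (Dir r)

/-- The purple subgraph `PI(G)`. -/
def LTT.purple {r : ℕ} (G : LTT r) : SimpleGraph {d : Dir r // d ∉ G.red} :=
  G.colored.induce {d | d ∉ G.red}

/-- `{d, d'}` is a purple edge. -/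
def LTT.IsPurpleEdge {r : ℕ} (G : LTT r) (d d' : Dir r) : Prop :=
  d ∉ G.red ∧ d' ∉ G.red ∧ G.colored.Adj d d'

/-- `[u, v]` is a red edge from the red vertex `u` to the purple vertex `v`. -/
def LTT.IsRedEdge {r : ℕ} (G : LTT r) (u v : Dir r) : Prop :=
  u ∈ G.red ∧ v ∉ G.red ∧ G.colored.Adj u v

/-- An `(r; (3/2 - r))` ltt structure: there is a unique red vertex (so there are exactly `2r - 1`
purple ones), a unique red edge, and the purple graph is connected. -/
structure LTT.IsType {r : ℕ} (G : LTT r) : Prop where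
  purple_connected : G.purple.Connected
  unique_red_vertex : ∃! u, u ∈ G.red
  unique_red_edge : ∃! e : Sym2 (Dir r), e ∈ G.colored.edgeSet ∧ ∃ u ∈ e, u ∈ G.red

/-- Birecurrence: there is a bi-infinite smooth path (alternating between black edges, here the
oriented edges `ℓ n`, and colored edges, here joining `bar (ℓ n)` to `ℓ (n + 1)`) that traverses
each black edge and each colored edge infinitely often towards each of its two ends. -/
def LTT.IsAdmissible {r : ℕ} (G : LTT r) : Prop :=
  ∃ ℓ : ℤ → Dir r,
    (∀ n, G.colored.Adj (ℓ n).bar (ℓ (n + 1))) ∧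
    (∀ (i : Fin r) (N : ℤ), (∃ n ≥ N, (ℓ n).1 = i) ∧ (∃ n ≤ N, (ℓ n).1 = i)) ∧
    (∀ (d d' : Dir r), G.colored.Adj d d' → ∀ N : ℤ,
      (∃ n ≥ N, s((ℓ n).bar, ℓ (n + 1)) = s(d, d')) ∧
      (∃ n ≤ N, s((ℓ n).bar, ℓ (n + 1)) = s(d, d')))

/-- The ltt structure `G(g)` of a map `g` of roses: the red vertices are the nonperiodic
directions, and the colored edges (the edges of the local Whitehead graph) are the turns taken by
some `g^k(e)`. -/
def EdgeMap.ltt {r : ℕ} (W : EdgeMap r) : LTT r where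
  red := {d | ¬ W.IsPeriodic d}
  colored :=
    { Adj := fun d d' => d ≠ d' ∧ ∃ (k : ℕ) (e : Dir r), TakesTurn (W.iter k e) d d'
      symm := ⟨fun d d' h => ⟨h.1.symm, by
        obtain ⟨k, e, a, b, hab, hh⟩ := h.2
        exact ⟨k, e, a, b, hab, hh.symm⟩⟩⟩
      loopless := ⟨fun d h => h.1 rfl⟩ }

/-- The ltt structure whose only red vertex is `u`, whose only red edge is `[u, v]`, and whose
purple graph is the complete graph on the remaining `2r - 1` vertices. -/
def LTT.complete {r : ℕ} (u v : Dir r) : LTT r where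
  red := {u}
  colored :=
    { Adj := fun d d' => d ≠ d' ∧
        ((d ≠ u ∧ d' ≠ u) ∨ (d = u ∧ d' = v) ∨ (d = v ∧ d' = u))
      symm := ⟨by rintro d d' ⟨h, h'⟩; exact ⟨h.symm, by tauto⟩⟩
      loopless := ⟨fun d h => h.1 rfl⟩ }

/-! ### Folds, switches, extensions and admissible compositions -/

/-- A proper full fold of edge-indexed roses, `u ↦ a u`: the oriented edge `u` is mapped to the edge
path `a u`, and all edges other than `u` and `bar u` are mapped to the edge with the same index. -/
@[ext] structure Fold (r : ℕ) where
  u : Dir r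
  a : Dir r
  edge_ne : a.1 ≠ u.1

/-- The fold `u ↦ a u` on edges. -/
def Fold.edgeMap {r : ℕ} (f : Fold r) : EdgeMap r := fun d =>
  if d = f.u then [f.a, f.u] else if d = f.u.bar then [f.u.bar, f.a.bar] else [d]

/-- The fold as a continuous map of roses (linear on each half of the folded edge). -/
noncomputable def Fold.toMap {r : ℕ} (f : Fold r) : C(Rose r, Rose r) :=
  Rose.mapOfLoops fun i => Rose.wordPath (f.edgeMap (i, true))

/-- The composition `g_n ∘ ⋯ ∘ g_1` of the list `[g_1, …, g_n]`, on edges. -/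
def composeEdgeMap {r : ℕ} : List (Fold r) → EdgeMap r
  | [] => fun d => [d]
  | g :: L => fun d => (g.edgeMap d).flatMap (composeEdgeMap L)

/-- The composition `g_n ∘ ⋯ ∘ g_1` of the list `[g_1, …, g_n]`, as a continuous map. -/
noncomputable def composeMap {r : ℕ} : List (Fold r) → C(Rose r, Rose r)
  | [] => ContinuousMap.id _
  | g :: L => (composeMap L).comp g.toMap

/-- `(g, G, G')` is a generating triple. The folded edge `u` and the edge `a` it is folded over
label the unachieved direction `d^u` and the twice-achieved direction `d^a` of `G'`, i.e. the red
edge of `G'` is `[u, bar a]`. The induced map of ltt structures exists, i.e. the direction map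
sends colored edges to colored edges, and restricts to an isomorphism of the purple graphs. -/
structure IsGeneratingTriple {r : ℕ} (g : Fold r) (G G' : LTT r) : Prop where
  source_type : G.IsType
  target_type : G'.IsType
  red_edge : G'.IsRedEdge g.u g.a.bar
  induced : ∀ d d', G.colored.Adj d d' →
    G'.colored.Adj (g.edgeMap.dir d) (g.edgeMap.dir d')
  purple_bij : Set.BijOn g.edgeMap.dir G.redᶜ G'.redᶜ
  purple_iso : ∀ d d', d ∉ G.red → d' ∉ G.red →
    (G.colored.Adj d d' ↔ G'.colored.Adj (g.edgeMap.dir d) (g.edgeMap.dir d'))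

/-- The generating triple is the extension determined by some purple edge `[d^a, l]` of `G'`: the
direction map is the identity (on labels) on the purple vertices, the red vertex of `G` is the
direction `u` of the folded edge, and the red edge of `G` ends at `l`. -/
def IsExtension {r : ℕ} (g : Fold r) (G G' : LTT r) : Prop :=
  IsGeneratingTriple g G G' ∧ (∀ d, d ∉ G.red → g.edgeMap.dir d = d) ∧
    ∃ l, G'.IsPurpleEdge g.a l ∧ G.IsRedEdge g.u l

/-- The generating triple is the switch determined by some purple edge `[d^a, l]` of `G'`: the
direction map sends `u` to `a` and is the identity (on labels) on the other purple vertices, the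
red vertex of `G` is the direction `a`, and the red edge of `G` ends at `l`. -/
def IsSwitch {r : ℕ} (g : Fold r) (G G' : LTT r) : Prop :=
  IsGeneratingTriple g G G' ∧
    (g.u ∉ G.red ∧ g.edgeMap.dir g.u = g.a ∧
      ∀ d, d ∉ G.red → d ≠ g.u → g.edgeMap.dir d = d) ∧
    ∃ l, G'.IsPurpleEdge g.a l ∧ G.IsRedEdge g.a l

/-- `(g_1, …, g_k; G_0, …, G_k)` is an admissible composition (`g i` stands for `g_{i+1}`): each
`(g_{i+1}, G_i, G_{i+1})` is an extension or a switch, and each `G_i` is an admissible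
`(r; (3/2 - r))` ltt structure. -/
structure IsAdmissibleComposition {r k : ℕ} (g : Fin k → Fold r) (G : Fin (k + 1) → LTT r) :
    Prop where
  type : ∀ i, (G i).IsType
  step : ∀ i : Fin k,
    IsExtension (g i) (G i.castSucc) (G i.succ) ∨ IsSwitch (g i) (G i.castSucc) (G i.succ)
  admissible : ∀ i, (G i).IsAdmissible

/-! ### Ideally decomposed representatives and periodic Nielsen paths -/

/-- The list `[g_1, …, g_n]` of folds is an ideal decomposition of `g = g_n ∘ ⋯ ∘ g_1`: the map `g`
is a train track, and its direction map fixes every direction except possibly that of the edge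
folded by `g_n`. -/
structure IsIdealDecomposition {r : ℕ} (L : List (Fold r)) : Prop where
  ne_nil : L ≠ []
  trainTrack : (composeEdgeMap L).IsTrainTrack
  fixed : ∀ d, d ≠ (L.getLast ne_nil).u → (composeEdgeMap L).dir d = d

/-- The ltt structure `G_j = G(f_j)` attached to the decomposition `[g_1, …, g_n]`, where
`f_j = g_j ∘ ⋯ ∘ g_1 ∘ g_n ∘ ⋯ ∘ g_{j+1}` for `0 ≤ j ≤ n`. -/
def associatedLTT {r : ℕ} (L : List (Fold r)) (j : ℕ) : LTT r :=
  (composeEdgeMap (L.rotate j)).ltt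

/-- `f` has a periodic Nielsen path: a nontrivial path `ρ` (not homotopic rel endpoints to a
constant path) such that `f^k(ρ)` is homotopic to `ρ` rel endpoints for some `k ≥ 1`. In
particular the endpoints are fixed by `f^k`; they may be any points of the space. -/
def HasPeriodicNielsenPath {X : Type*} [TopologicalSpace X] (f : C(X, X)) : Prop :=
  ∃ (k : ℕ) (p q : X) (ρ : Path p q), 0 < k ∧
    (¬ ∃ h : q = p, ρ.Homotopic ((Path.refl p).cast rfl h)) ∧
    ∃ (hp : p = f^[k] p) (hq : q = f^[k] q),
      ((ρ.map (f.continuous.iterate k)).cast hp hq).Homotopic ρ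

/-- A relabeling `σ` of the directions by an edge pair permutation carries the triple `(g, G₀, G₁)`
to the triple `(g', G₀', G₁')`. -/
def TripleEquivalent {r : ℕ} (σ : Equiv.Perm (Dir r)) (g : Fold r) (G₀ G₁ : LTT r)
    (g' : Fold r) (G₀' G₁' : LTT r) : Prop :=
  (g'.u = σ g.u ∧ g'.a = σ g.a) ∧
  ((∀ d, d ∈ G₀.red ↔ σ d ∈ G₀'.red) ∧
    ∀ d d', G₀.colored.Adj d d' ↔ G₀'.colored.Adj (σ d) (σ d')) ∧
  ((∀ d, d ∈ G₁.red ↔ σ d ∈ G₁'.red) ∧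
    ∀ d d', G₁.colored.Adj d d' ↔ G₁'.colored.Adj (σ d) (σ d'))

/-- `(g_1, …, g_k; G_0, …, G_k)` is a Nielsen path prevention sequence: it is an admissible
composition, and no ideally decomposed irreducible representative
`(g_1', …, g_{k+m}'; G_0', …, G_{k+m}')` whose first `k` triples are equivalent to the given ones
(by a common edge pair permutation of the labels) has a periodic Nielsen path. -/
def IsNielsenPathPreventionSequence {r k : ℕ} (g : Fin k → Fold r) (G : Fin (k + 1) → LTT r) :
    Prop :=
  IsAdmissibleComposition g G ∧
  ∀ (m : ℕ) (g' : Fin (k + m) → Fold r),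
    IsIdealDecomposition (List.ofFn g') →
    (composeEdgeMap (List.ofFn g')).transitionMatrix.IsIrreducible →
    ∀ σ : Equiv.Perm (Dir r), (∀ d, σ d.bar = (σ d).bar) →
    (∀ i : Fin k, TripleEquivalent σ (g i) (G i.castSucc) (G i.succ)
      (g' (Fin.castAdd m i)) (associatedLTT (List.ofFn g') i)
      (associatedLTT (List.ofFn g') (i + 1))) →
    ¬ HasPeriodicNielsenPath (composeMap (List.ofFn g'))

/-! ### Edge paths as words in the oriented edges -/

/-! That the sequence is an admissible composition is a direct check. Because the purple graphs are
complete, the direction map of each fold is automatically an isomorphism between them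
(`isSwitch_complete`, `isExtension_complete`). Birecurrence holds because every oriented edge can be
reached from every other by steps along the structure (`LTT.isAdmissible_complete`).

For Nielsen paths, let `f` be the full composition and call an edge path smooth if it takes only
turns of `G_0`. Since `f` is a train track and `G_j` records the turns taken by iterates of `f_j`,
the remaining folds after the first `j` send paths smooth for `G_j` to paths smooth for `G_0`
(`IsSmooth.wordMap`). The heart is `tightensTo_of_isSmooth`: if two smooth paths leave the vertex,
then after their images under `f` cancel a common initial segment, what remains is joined smoothly.
Only turns at `x` can cause trouble. Each of the first three folds leaves a single continuation for
which the paths may go on agreeing: `x` against `z`, then `w` against `z`, then `w` against `y.bar`.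
After that the first path would have to continue by `x` or `z`. The letter `x` cannot follow `w`
because `x` is red in `G_0` and joined only to `y`; for `z`, the fourth fold cancels one more edge
and the fifth separates the paths.

Hence `f` sends a concatenation of two smooth paths to a smooth path up to homotopy, and a product
of `n + 2` smooth classes to a product of `n + 1` (`IsSmoothProduct.map_succ`). Every class is a
finite product of straight segments, hence of smooth classes (`Rose.induction_of_isSeg`). A periodic
class equals its own image under a power of `f`, so it is a single smooth class. By irreducibility
every petal is folded, so `f` at least doubles the length of a smooth path, and no cancellation
occurs. A nontrivial periodic class would therefore contain arbitrarily long reduced edge paths.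
This contradicts `exists_length_le`, where the sheet reached by a lift to the universal cover bounds
their length. -/

@[simp] lemma Dir.bar_bar {r : ℕ} (d : Dir r) : d.bar.bar = d := by
  simp [Dir.bar]

@[simp] lemma Dir.bar_fst {r : ℕ} (d : Dir r) : d.bar.1 = d.1 := rfl

lemma Dir.bar_ne {r : ℕ} (d : Dir r) : d.bar ≠ d := by
  intro h
  have := congrArg Prod.snd h
  simp [Dir.bar] at this

@[simp] lemma Dir.bar_inj {r : ℕ} {d e : Dir r} : d.bar = e.bar ↔ d = e :=
  ⟨fun h => by rw [← d.bar_bar, h, e.bar_bar], fun h => by rw [h]⟩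

lemma Dir.bar_eq_iff {r : ℕ} {d e : Dir r} : d.bar = e ↔ d = e.bar := by
  rw [← Dir.bar_inj, Dir.bar_bar]

lemma Dir.eq_or_eq_bar {r : ℕ} {d e : Dir r} (h : d.1 = e.1) : d = e ∨ d = e.bar := by
  obtain ⟨i, b⟩ := d
  obtain ⟨j, c⟩ := e
  obtain rfl : i = j := h
  cases b <;> cases c <;> simp [Dir.bar]

lemma Dir.ne_of_fst_ne {r : ℕ} {d e : Dir r} (h : d.1 ≠ e.1) : d ≠ e := fun h' => h (h' ▸ rfl)

/-- The edge path run backwards. -/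
def invWord {r : ℕ} (w : List (Dir r)) : List (Dir r) := (w.map Dir.bar).reverse

@[simp] lemma invWord_nil {r : ℕ} : invWord ([] : List (Dir r)) = [] := rfl

@[simp] lemma invWord_cons {r : ℕ} (d : Dir r) (w : List (Dir r)) :
    invWord (d :: w) = invWord w ++ [d.bar] := by
  simp [invWord]

@[simp] lemma invWord_append {r : ℕ} (v w : List (Dir r)) :
    invWord (v ++ w) = invWord w ++ invWord v := by
  simp [invWord]

@[simp] lemma invWord_invWord {r : ℕ} (w : List (Dir r)) : invWord (invWord w) = w := by
  induction w with
  | nil => rfl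
  | cons d w ih => simp [ih]

lemma List.IsInfix.invWord {r : ℕ} {v w : List (Dir r)} (h : v <:+: w) :
    invWord v <:+: invWord w := by
  obtain ⟨s, t, rfl⟩ := h
  exact ⟨_root_.invWord t, _root_.invWord s, by simp⟩

lemma List.IsInfix.flatMap' {α β : Type*} {v w : List α} (h : v <:+: w) (f : α → List β) :
    v.flatMap f <:+: w.flatMap f := by
  obtain ⟨s, t, rfl⟩ := h
  exact ⟨s.flatMap f, t.flatMap f, by simp⟩

/-! ### Folds on words -/

namespace Fold

variable {r : ℕ} (g : Fold r)

lemma edgeMap_u : g.edgeMap g.u = [g.a, g.u] := by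
  simp [edgeMap]

lemma edgeMap_u_bar : g.edgeMap g.u.bar = [g.u.bar, g.a.bar] := by
  simp [edgeMap, Dir.bar_ne]

lemma edgeMap_of_fst_ne {d : Dir r} (h : d.1 ≠ g.u.1) : g.edgeMap d = [d] := by
  have h₁ : d ≠ g.u := Dir.ne_of_fst_ne h
  have h₂ : d ≠ g.u.bar := Dir.ne_of_fst_ne h
  simp [edgeMap, h₁, h₂]

lemma edgeMap_of_ne {d : Dir r} (h : d ≠ g.u) : ∃ w, g.edgeMap d = d :: w := by
  by_cases h' : d = g.u.bar
  · exact ⟨_, h' ▸ g.edgeMap_u_bar⟩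
  · exact ⟨[], by simp [edgeMap, h, h']⟩

lemma dir_u : g.edgeMap.dir g.u = g.a := by
  simp [EdgeMap.dir, edgeMap_u]

lemma dir_of_ne {d : Dir r} (h : d ≠ g.u) : g.edgeMap.dir d = d := by
  obtain ⟨w, hw⟩ := g.edgeMap_of_ne h
  simp [EdgeMap.dir, hw]

lemma edgeMap_bar (d : Dir r) : g.edgeMap d.bar = invWord (g.edgeMap d) := by
  by_cases h : d.1 = g.u.1
  · rcases Dir.eq_or_eq_bar h with rfl | rfl
    · simp [edgeMap_u, edgeMap_u_bar]
    · simp [edgeMap_u, edgeMap_u_bar]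
  · rw [edgeMap_of_fst_ne g h, edgeMap_of_fst_ne g (by simpa using h)]
    simp

lemma self_mem_edgeMap (d : Dir r) : d ∈ g.edgeMap d := by
  by_cases h : d = g.u
  · subst h
    simp [edgeMap_u]
  · obtain ⟨w, hw⟩ := g.edgeMap_of_ne h
    simp [hw]

end Fold

/-- The image of an edge path under a composition of folds (without tightening). -/
def wordMap {r : ℕ} (L : List (Fold r)) (w : List (Dir r)) : List (Dir r) :=
  w.flatMap (composeEdgeMap L)

section wordMap

variable {r : ℕ} (L P Q : List (Fold r))

@[simp] lemma wordMap_nil : wordMap L [] = [] := rfl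

@[simp] lemma wordMap_append (v w : List (Dir r)) :
    wordMap L (v ++ w) = wordMap L v ++ wordMap L w := by
  simp [wordMap]

@[simp] lemma wordMap_singleton (d : Dir r) : wordMap L [d] = composeEdgeMap L d := by
  simp [wordMap]

lemma wordMap_cons (d : Dir r) (w : List (Dir r)) :
    wordMap L (d :: w) = composeEdgeMap L d ++ wordMap L w := by
  simp [wordMap]

lemma wordMap_fold_cons (g : Fold r) (w : List (Dir r)) :
    wordMap (g :: L) w = wordMap L (w.flatMap g.edgeMap) := by
  simp only [wordMap, composeEdgeMap, List.flatMap_assoc]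

@[simp] lemma wordMap_id (w : List (Dir r)) : wordMap [] w = w := by
  simp [wordMap, composeEdgeMap]

lemma wordMap_comp (w : List (Dir r)) : wordMap (P ++ Q) w = wordMap Q (wordMap P w) := by
  induction P generalizing w with
  | nil => simp
  | cons g P ih => rw [List.cons_append, wordMap_fold_cons, wordMap_fold_cons, ih]

lemma flatMap_invWord {W : EdgeMap r} (h : ∀ d, W (Dir.bar d) = invWord (W d))
    (w : List (Dir r)) : (invWord w).flatMap W = invWord (w.flatMap W) := by
  induction w with
  | nil => rfl
  | cons e w ih => simp [ih, h]

lemma composeEdgeMap_bar (d : Dir r) : composeEdgeMap L d.bar = invWord (composeEdgeMap L d) := by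
  induction L generalizing d with
  | nil => rfl
  | cons g L ih =>
    change (g.edgeMap d.bar).flatMap _ = invWord ((g.edgeMap d).flatMap _)
    rw [g.edgeMap_bar, flatMap_invWord ih]

lemma wordMap_invWord (w : List (Dir r)) : wordMap L (invWord w) = invWord (wordMap L w) :=
  flatMap_invWord (composeEdgeMap_bar L) w

lemma self_mem_composeEdgeMap (d : Dir r) : d ∈ composeEdgeMap L d := by
  induction L with
  | nil => simp [composeEdgeMap]
  | cons g L ih => exact List.mem_flatMap.2 ⟨d, g.self_mem_edgeMap d, ih⟩

lemma composeEdgeMap_ne_nil (d : Dir r) : composeEdgeMap L d ≠ [] :=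
  List.ne_nil_of_mem (self_mem_composeEdgeMap L d)

lemma List.IsInfix.wordMap {v w : List (Dir r)} (h : v <:+: w) :
    wordMap L v <:+: wordMap L w :=
  h.flatMap' _

lemma List.IsInfix.wordMap_iterate {v w : List (Dir r)} (h : v <:+: w) (k : ℕ) :
    (_root_.wordMap L)^[k] v <:+: (_root_.wordMap L)^[k] w := by
  induction k generalizing v w with
  | zero => exact h
  | succ k ih => exact ih (h.wordMap L)

lemma wordMap_iterate_invWord (k : ℕ) (w : List (Dir r)) :
    (wordMap L)^[k] (invWord w) = invWord ((wordMap L)^[k] w) := by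
  induction k generalizing w with
  | zero => rfl
  | succ k ih => rw [Function.iterate_succ_apply, Function.iterate_succ_apply, wordMap_invWord, ih]

lemma composeEdgeMap_eq_singleton {i : Fin r} (h : ∀ g ∈ L, g.u.1 ≠ i) {d : Dir r}
    (hd : d.1 = i) : composeEdgeMap L d = [d] := by
  induction L with
  | nil => rfl
  | cons g L ih =>
    have : composeEdgeMap L d = [d] := ih fun g' hg' => h g' (List.mem_cons_of_mem _ hg')
    have hg := h g List.mem_cons_self
    simp only [composeEdgeMap, g.edgeMap_of_fst_ne (d := d) (by rw [hd]; exact hg.symm)]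
    simpa using this

end wordMap

/-! ### Smooth edge paths -/

/-- An edge path is smooth if it only takes turns that are edges of the graph `G`. -/
def IsSmooth {r : ℕ} (G : SimpleGraph (Dir r)) (w : List (Dir r)) : Prop :=
  w.IsChain fun e e' => G.Adj e.bar e'

lemma IsSmooth.invWord {r : ℕ} {G : SimpleGraph (Dir r)} {w : List (Dir r)} (h : IsSmooth G w) :
    IsSmooth G (invWord w) := by
  unfold IsSmooth _root_.invWord
  rw [List.isChain_reverse, List.isChain_map]
  refine h.imp fun a b hab => ?_
  simpa using hab.symm

lemma IsSmooth.infix {r : ℕ} {G : SimpleGraph (Dir r)} {v w : List (Dir r)} (h : IsSmooth G w)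
    (hv : v <:+: w) : IsSmooth G v :=
  List.IsChain.infix h hv

/-! ### Turns taken by iterates, and passage between cyclic rotations of the decomposition. -/

section taken

variable {r : ℕ} {L P Q : List (Fold r)}

/-- Some iterate of the image of an edge passes through `e` and then immediately through `e'`. -/
def IsTaken (L : List (Fold r)) (e e' : Dir r) : Prop :=
  ∃ k d, [e, e'] <:+: (wordMap L)^[k] [d]

lemma IsTaken.bar {e e' : Dir r} (h : IsTaken L e e') : IsTaken L e'.bar e.bar := by
  obtain ⟨k, d, h⟩ := h
  refine ⟨k, d.bar, ?_⟩
  have := h.invWord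
  rw [← wordMap_iterate_invWord] at this
  simpa using this

/-- Reversing an iterate turns a passage through `e e'` into one through `e'.bar e.bar`, so the
unordered turn can always be read in the stated order. -/
lemma ltt_colored_adj_iff {e e' : Dir r} :
    (composeEdgeMap L).ltt.colored.Adj e.bar e' ↔ e.bar ≠ e' ∧ IsTaken L e e' := by
  constructor
  · rintro ⟨hne, k, d, a, b, hab, ⟨h₁, h₂⟩ | ⟨h₁, h₂⟩⟩
    · rw [Dir.bar_inj] at h₁
      subst h₁ h₂
      exact ⟨hne, k, d, hab⟩
    · subst h₁ h₂
      have : IsTaken L a e.bar := ⟨k, d, hab⟩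
      exact ⟨hne, by simpa using this.bar⟩
  · rintro ⟨hne, k, d, h⟩
    exact ⟨hne, k, d, e, e', h, Or.inl ⟨rfl, rfl⟩⟩

lemma wordMap_iterate_rotate (k : ℕ) (w : List (Dir r)) :
    wordMap Q ((wordMap (Q ++ P))^[k] w) = (wordMap (P ++ Q))^[k] (wordMap Q w) := by
  induction k generalizing w with
  | zero => rfl
  | succ k ih =>
    rw [Function.iterate_succ_apply, Function.iterate_succ_apply, ih, wordMap_comp Q P,
      wordMap_comp P Q]

/-- Conjugation by `Q` moves iterates of one rotation to iterates of the other, applied to the image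
of `d` under `Q`. As `d` occurs in its own image under `P`, that image lies inside one full iterate
of `d`. Thus turns seen after applying `Q` are turns of the other rotation. -/
lemma exists_wordMap_iterate_infix (k : ℕ) (d : Dir r) :
    wordMap Q ((wordMap (Q ++ P))^[k] [d]) <:+: (wordMap (P ++ Q))^[k + 1] [d] := by
  rw [wordMap_iterate_rotate, Function.iterate_succ_apply]
  refine List.IsInfix.wordMap_iterate _ ?_ k
  rw [wordMap_comp]
  refine List.IsInfix.wordMap _ ?_
  rw [wordMap_singleton]
  obtain ⟨s, t, h⟩ := List.append_of_mem (self_mem_composeEdgeMap P d)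
  exact ⟨s, t, by simp [h]⟩

lemma isSmooth_of_infix_iterate (hL : (composeEdgeMap L).IsTrainTrack) {k : ℕ} {d : Dir r}
    {w : List (Dir r)} (h : w <:+: (wordMap L)^[k] [d]) :
    IsSmooth (composeEdgeMap L).ltt.colored w := by
  have hc : w.IsChain (fun e e' => e' ≠ e.bar) := List.IsChain.infix (hL d k) h
  unfold IsSmooth
  rw [List.isChain_iff_forall_rel_of_append_cons_cons] at hc ⊢
  rintro e e' s t rfl
  exact ltt_colored_adj_iff.2 ⟨(hc rfl).symm, k, d,
    List.IsInfix.trans ⟨s, t, by simp⟩ h⟩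

lemma IsTaken.isSmooth_wordMap (hL : (composeEdgeMap (P ++ Q)).IsTrainTrack) {e e' : Dir r}
    (h : IsTaken (Q ++ P) e e') :
    IsSmooth (composeEdgeMap (P ++ Q)).ltt.colored (wordMap Q [e, e']) := by
  obtain ⟨k, d, h⟩ := h
  exact isSmooth_of_infix_iterate hL ((h.wordMap Q).trans (exists_wordMap_iterate_infix k d))

lemma isSmooth_composeEdgeMap (hL : (composeEdgeMap (P ++ Q)).IsTrainTrack) (d : Dir r) :
    IsSmooth (composeEdgeMap (P ++ Q)).ltt.colored (composeEdgeMap Q d) := by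
  have := exists_wordMap_iterate_infix (P := P) (Q := Q) 0 d
  rw [Function.iterate_zero_apply, wordMap_singleton] at this
  exact isSmooth_of_infix_iterate hL this

/-- The second half of the composition of a train track map maps the smooth paths of the
intermediate structure to smooth paths. -/
lemma IsSmooth.wordMap (hL : (composeEdgeMap (P ++ Q)).IsTrainTrack) {w : List (Dir r)}
    (h : IsSmooth (composeEdgeMap (Q ++ P)).ltt.colored w) :
    IsSmooth (composeEdgeMap (P ++ Q)).ltt.colored (wordMap Q w) := by
  unfold IsSmooth _root_.wordMap at *
  rw [List.flatMap, List.isChain_flatten (by simp [composeEdgeMap_ne_nil]), List.isChain_map]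
  -- A concatenation is smooth if its blocks are and the junctions are. The junction between the
  -- images of `e` and `e'` depends only on the taken two-letter word `e e'`.
  refine ⟨fun l hl => ?_, h.imp fun e e' hee' => ?_⟩
  · obtain ⟨d, -, rfl⟩ := List.mem_map.1 hl
    exact isSmooth_composeEdgeMap hL d
  have := (ltt_colored_adj_iff.1 hee').2.isSmooth_wordMap hL
  rw [wordMap_cons, wordMap_singleton, IsSmooth, List.isChain_append] at this
  exact this.2.2

end taken

/-! ### Tightening the image of a path with one turn -/

/-- After cancelling a common initial segment, the images of the edge paths `v` and `w` leave
their common initial vertex along a turn of `G`. -/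
def TightensTo {r : ℕ} (G : SimpleGraph (Dir r)) (L : List (Fold r)) (v w : List (Dir r)) : Prop :=
  ∃ c v' w', wordMap L v = c ++ v' ∧ wordMap L w = c ++ w' ∧ IsSmooth G (invWord v' ++ w')

section tightens

variable {r : ℕ} {G : SimpleGraph (Dir r)} {L : List (Fold r)} {v w : List (Dir r)}

lemma TightensTo.symm (h : TightensTo G L v w) : TightensTo G L w v := by
  obtain ⟨c, v', w', hv, hw, h⟩ := h
  exact ⟨c, w', v', hw, hv, by simpa using h.invWord⟩

lemma TightensTo.of_isSmooth (h : IsSmooth G (wordMap L (invWord v ++ w))) :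
    TightensTo G L v w :=
  ⟨[], _, _, rfl, rfl, by rwa [wordMap_append, wordMap_invWord] at h⟩

lemma TightensTo.cons (d : Dir r) (h : TightensTo G L v w) :
    TightensTo G L (d :: v) (d :: w) := by
  obtain ⟨c, v', w', hv, hw, h⟩ := h
  exact ⟨composeEdgeMap L d ++ c, v', w', by simp [hv, wordMap_cons], by simp [hw, wordMap_cons], h⟩

lemma TightensTo.of_fold {g : Fold r} (h : TightensTo G L (v.flatMap g.edgeMap)
    (w.flatMap g.edgeMap)) : TightensTo G (g :: L) v w := by
  obtain ⟨c', v', w', hv, hw, h⟩ := h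
  exact ⟨c', v', w', by rw [wordMap_fold_cons, hv], by rw [wordMap_fold_cons, hw], h⟩

end tightens

/-! ### Extensions and switches between complete structures -/

namespace LTT

variable {r : ℕ} {u v : Dir r}

@[simp] lemma mem_complete_red {d : Dir r} : d ∈ (complete u v).red ↔ d = u := Iff.rfl

lemma complete_adj {d d' : Dir r} : (complete u v).colored.Adj d d' ↔
    d ≠ d' ∧ ((d ≠ u ∧ d' ≠ u) ∨ (d = u ∧ d' = v) ∨ (d = v ∧ d' = u)) := Iff.rfl

lemma complete_adj_of_ne {d d' : Dir r} (h : d ≠ d') (hd : d ≠ u) (hd' : d' ≠ u) :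
    (complete u v).colored.Adj d d' := ⟨h, Or.inl ⟨hd, hd'⟩⟩

lemma complete_adj_red (h : u ≠ v) : (complete u v).colored.Adj u v := ⟨h, Or.inr (Or.inl ⟨rfl, rfl⟩)⟩

lemma isType_complete (h : u ≠ v) : (complete u v).IsType where
  purple_connected := by
    have : Nonempty {d : Dir r // d ∉ (complete u v).red} := ⟨⟨v, h.symm⟩⟩
    refine SimpleGraph.Connected.mk fun a b => ?_
    by_cases hab : a = b
    · rw [hab]
    · exact SimpleGraph.Adj.reachable
        (complete_adj_of_ne (fun h => hab (Subtype.ext h)) a.2 b.2)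
  unique_red_vertex := ⟨u, rfl, fun _ h => h⟩
  unique_red_edge := by
    refine ⟨s(u, v), ⟨complete_adj_red h, u, Sym2.mem_mk_left u v, rfl⟩, ?_⟩
    rintro e ⟨he, d, hd, rfl : d = u⟩
    obtain ⟨d', rfl⟩ := hd
    rw [SimpleGraph.mem_edgeSet, complete_adj] at he
    rcases he with ⟨hne, ⟨h', -⟩ | ⟨-, rfl⟩ | ⟨-, rfl⟩⟩
    · exact absurd rfl h'
    · rfl
    · exact absurd rfl hne

lemma isRedEdge_complete (h : u ≠ v) : (complete u v).IsRedEdge u v :=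
  ⟨rfl, h.symm, complete_adj_red h⟩

end LTT

section steps

variable {r : ℕ} (g : Fold r) {l : Dir r}

lemma Fold.a_ne_u : g.a ≠ g.u := Dir.ne_of_fst_ne g.edge_ne

lemma Fold.u_ne_a_bar : g.u ≠ g.a.bar := Dir.ne_of_fst_ne g.edge_ne.symm

/-- The direction map only moves `u` to `a`, so it carries the complement of `a` bijectively onto
the complement of `u`; with complete purple graphs nothing else is needed for the isomorphism. The
red edge `[a, l]` stays put and becomes purple. -/
lemma isSwitch_complete (hla : l ≠ g.a) (hlu : l ≠ g.u) :
    IsSwitch g (LTT.complete g.a l) (LTT.complete g.u g.a.bar) := by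
  have hau := g.a_ne_u
  have hdir : ∀ d, g.edgeMap.dir d = if d = g.u then g.a else d := by
    intro d
    split_ifs with h
    · rw [h, g.dir_u]
    · exact g.dir_of_ne h
  have hmaps : ∀ d, d ≠ g.a → g.edgeMap.dir d ≠ g.u := by
    intro d _ h
    rw [hdir] at h
    split_ifs at h with h'
    exacts [hau h, h' h]
  have hinj : ∀ d d', d ≠ g.a → d' ≠ g.a → g.edgeMap.dir d = g.edgeMap.dir d' → d = d' := by
    intro d d' h h' e
    rw [hdir, hdir] at e
    split_ifs at e <;> simp_all
  refine ⟨⟨LTT.isType_complete hla.symm, LTT.isType_complete g.u_ne_a_bar,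
    LTT.isRedEdge_complete g.u_ne_a_bar, ?_, ⟨fun d hd => hmaps d hd, ?_, ?_⟩, ?_⟩, ⟨?_, ?_, ?_⟩, l, ?_, ?_⟩
  · rintro d d' ⟨hne, ⟨h, h'⟩ | ⟨rfl, rfl⟩ | ⟨rfl, rfl⟩⟩
    · exact LTT.complete_adj_of_ne (fun e => hne (hinj d d' h h' e)) (hmaps d h) (hmaps d' h')
    · rw [g.dir_of_ne hau, g.dir_of_ne hlu]
      exact LTT.complete_adj_of_ne hla.symm hau hlu
    · rw [g.dir_of_ne hau, g.dir_of_ne hlu]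
      exact LTT.complete_adj_of_ne hla hlu hau
  · exact fun d hd d' hd' e => hinj d d' hd hd' e
  · intro d hd
    by_cases h : d = g.a
    · exact ⟨g.u, hau.symm, by rw [g.dir_u, h]⟩
    · exact ⟨d, h, g.dir_of_ne hd⟩
  · intro d d' hd hd'
    constructor
    · exact fun h => LTT.complete_adj_of_ne (fun e => h.1 (hinj d d' hd hd' e)) (hmaps d hd)
        (hmaps d' hd')
    · exact fun h => LTT.complete_adj_of_ne (fun e => h.1 (by rw [e])) hd hd'
  · exact hau.symm
  · exact g.dir_u
  · exact fun d _ h => g.dir_of_ne h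
  · exact ⟨hau, hlu, LTT.complete_adj_of_ne hla.symm hau hlu⟩
  · exact LTT.isRedEdge_complete hla.symm

/-- Away from the red vertex `u` the direction map is the identity, and the red edge `[u, l]` is
carried to the purple edge `[a, l]`. -/
lemma isExtension_complete (hla : l ≠ g.a) (hlu : l ≠ g.u) :
    IsExtension g (LTT.complete g.u l) (LTT.complete g.u g.a.bar) := by
  have hau := g.a_ne_u
  refine ⟨⟨LTT.isType_complete hlu.symm, LTT.isType_complete g.u_ne_a_bar,
    LTT.isRedEdge_complete g.u_ne_a_bar, ?_, ⟨?_, ?_, ?_⟩, ?_⟩, ?_, l, ?_, ?_⟩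
  · rintro d d' ⟨hne, ⟨h, h'⟩ | ⟨rfl, rfl⟩ | ⟨rfl, rfl⟩⟩
    · rw [g.dir_of_ne h, g.dir_of_ne h']
      exact LTT.complete_adj_of_ne hne h h'
    · rw [g.dir_u, g.dir_of_ne hlu]
      exact LTT.complete_adj_of_ne hla.symm hau hlu
    · rw [g.dir_u, g.dir_of_ne hlu]
      exact LTT.complete_adj_of_ne hla hlu hau
  · intro d (hd : d ≠ g.u)
    rw [g.dir_of_ne hd]
    exact hd
  · intro d (hd : d ≠ g.u) d' (hd' : d' ≠ g.u) h
    rwa [g.dir_of_ne hd, g.dir_of_ne hd'] at h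
  · exact fun d (hd : d ≠ g.u) => ⟨d, hd, g.dir_of_ne hd⟩
  · intro d d' (hd : d ≠ g.u) (hd' : d' ≠ g.u)
    rw [g.dir_of_ne hd, g.dir_of_ne hd']
    exact ⟨fun h => LTT.complete_adj_of_ne h.1 hd hd', fun h => LTT.complete_adj_of_ne h.1 hd hd'⟩
  · exact fun d (hd : d ≠ g.u) => g.dir_of_ne hd
  · exact ⟨hau, hlu, LTT.complete_adj_of_ne hla.symm hau hlu⟩
  · exact LTT.isRedEdge_complete hlu.symm

end steps

/-! ### Birecurrence -/

/-- In a strongly connected relation there is a closed walk that makes each of finitely many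
prescribed steps. -/
lemma exists_closed_walk {α : Type*} {R : α → α → Prop} (hR : ∀ a b, Relation.TransGen R a b)
    (a₀ : α) (S : List (α × α)) (hS : ∀ p ∈ S, R p.1 p.2) :
    ∃ w : List α, List.IsChain R (a₀ :: w ++ [a₀]) ∧ ∀ p ∈ S, [p.1, p.2] <:+: a₀ :: w ++ [a₀] := by
  have walk : ∀ a b, ∃ w, List.IsChain R (a :: w ++ [b]) := by
    intro a b
    induction hR a b with
    | single h => exact ⟨[], by simpa using h⟩
    | @tail b c _ h ih =>
      obtain ⟨w, hw⟩ := ih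
      refine ⟨w ++ [b], ?_⟩
      rw [← List.cons_append]
      exact List.IsChain.append_overlap (l₂ := [b]) (l₃ := [c]) hw (by simpa using h) (by simp)
  have glue : ∀ a b c (v w : List α), List.IsChain R (a :: v ++ [b]) →
      List.IsChain R (b :: w ++ [c]) → List.IsChain R (a :: (v ++ b :: w) ++ [c]) := by
    intro a b c v w hv hw
    have := List.IsChain.append_overlap (l₁ := a :: v) (l₂ := [b]) (l₃ := w ++ [c]) hv
      (by simpa using hw) (by simp)
    simpa using this
  induction S with
  | nil =>
    obtain ⟨w, hw⟩ := walk a₀ a₀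
    exact ⟨w, hw, by simp⟩
  | cons p S ih =>
    obtain ⟨w, hw, hw'⟩ := ih fun q hq => hS q (List.mem_cons_of_mem _ hq)
    obtain ⟨w₁, h₁⟩ := walk a₀ p.1
    obtain ⟨w₂, h₂⟩ := walk p.2 a₀
    have hp : List.IsChain R (p.1 :: [] ++ [p.2]) := by simpa using hS p List.mem_cons_self
    -- Travel to `p.1`, make the new step, return to `a₀`, then run the closed walk already found.
    refine ⟨w₁ ++ p.1 :: ([] ++ p.2 :: (w₂ ++ a₀ :: w)), ?_, ?_⟩
    · exact glue _ _ _ _ _ h₁ (glue _ _ _ _ _ hp (glue _ _ _ _ _ h₂ hw))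
    · intro q hq
      rcases List.mem_cons.1 hq with rfl | hq
      · exact ⟨a₀ :: w₁, w₂ ++ a₀ :: w ++ [a₀], by simp⟩
      · exact (hw' q hq).trans ⟨a₀ :: w₁ ++ p.1 :: p.2 :: w₂, [], by simp⟩

/-- In a strongly connected relation on a finite type there is a bi-infinite walk that makes each
possible step infinitely often in both directions. -/
lemma exists_birecurrent_walk {α : Type*} [Finite α] [Nonempty α] {R : α → α → Prop}
    (hR : ∀ a b, Relation.TransGen R a b) :
    ∃ ℓ : ℤ → α, (∀ n, R (ℓ n) (ℓ (n + 1))) ∧ ∀ a b, R a b → ∀ N : ℤ,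
      (∃ n ≥ N, ℓ n = a ∧ ℓ (n + 1) = b) ∧ (∃ n ≤ N, ℓ n = a ∧ ℓ (n + 1) = b) := by
  obtain ⟨S, hS⟩ : ∃ S : List (α × α), ∀ p, p ∈ S ↔ R p.1 p.2 :=
    ⟨(Set.toFinite {p : α × α | R p.1 p.2}).toFinset.toList, by simp⟩
  obtain ⟨a₀⟩ := ‹Nonempty α›
  obtain ⟨w, hw, hw'⟩ := exists_closed_walk hR a₀ S fun p hp => (hS p).1 hp
  set W := a₀ :: w ++ [a₀] with hW
  set m := w.length + 1 with hm
  have hlen : W.length = m + 1 := by simp [hW, hm]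
  have hm0 : (0 : ℤ) < m := by positivity
  have hget : ∀ k (h : k < m + 1), k = 0 ∨ k = m → W[k]'(hlen ▸ h) = a₀ := by
    rintro k h (rfl | rfl)
    · simp [hW]
    · simp [hW, hm]
  -- Repeat the closed walk with period `m`; the final `a₀` at index `m` is identified with the one
  -- at index `0`.
  let ℓ : ℤ → α := fun n => W.getD (n % m).toNat a₀
  have hℓ : ∀ (q : ℤ) (k : ℕ) (h : k < m + 1), ℓ (k + m * q) = W[k]'(hlen ▸ h) := by
    intro q k h
    simp only [ℓ, Int.add_mul_emod_self_left]
    rcases Nat.lt_succ_iff_lt_or_eq.1 h with h' | h'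
    · rw [Int.emod_eq_of_lt (by positivity) (by exact_mod_cast h'), Int.toNat_natCast,
        List.getD_eq_getElem]
    · rw [hget k h (Or.inr h')]
      subst h'
      rw [Int.emod_self, Int.toNat_zero, List.getD_eq_getElem _ _ (by omega)]
      exact hget 0 (by omega) (Or.inl rfl)
  refine ⟨ℓ, fun n => ?_, fun a b hab N => ?_⟩
  · obtain ⟨k, hk⟩ := Int.eq_ofNat_of_zero_le (Int.emod_nonneg n hm0.ne')
    have hkm : k < m := by exact_mod_cast hk ▸ Int.emod_lt_of_pos n hm0
    have hn : n = k + m * (n / m) := by rw [← hk, Int.emod_add_mul_ediv]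
    have hn' : n + 1 = (k + 1 : ℕ) + m * (n / m) := by push_cast; omega
    rw [hn', hℓ _ _ (by omega)]
    conv in ℓ n => rw [hn]
    rw [hℓ _ _ (by omega)]
    exact List.isChain_iff_getElem.1 hw k (by omega)
  · obtain ⟨s, t, hst⟩ := hw' (a, b) ((hS _).2 hab)
    have hl : s.length + 1 < m + 1 := by
      rw [← hlen, ← hst]
      simp
    have h₁ : ∀ q, ℓ (s.length + m * q) = a := by
      intro q
      rw [hℓ q s.length (by omega)]
      simp [← hst]
    have h₂ : ∀ q, ℓ (s.length + m * q + 1) = b := by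
      intro q
      rw [show (s.length + m * q + 1 : ℤ) = (s.length + 1 : ℕ) + m * q by push_cast; ring,
        hℓ q (s.length + 1) hl]
      simp [← hst]
    -- Since `1 ≤ m` and `s.length < m`, shifting one occurrence by `|N|` periods passes `N` to the
    -- right, and by `-|N| - m` periods to the left.
    refine ⟨⟨_, ?_, h₁ |N|, h₂ |N|⟩, ⟨_, ?_, h₁ (-|N| - m), h₂ (-|N| - m)⟩⟩
    · have := le_abs_self N
      have := abs_nonneg N
      nlinarith
    · have := neg_abs_le N
      have := abs_nonneg N
      have : (s.length : ℤ) < m := by omega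
      nlinarith

/-- Following one oriented edge by another is a strongly connected relation: off the red vertex only
backtracking is forbidden, and a detour over a further petal avoids it. The red edge gives the way
out of `u.bar` and the way into `u`. -/
lemma LTT.isAdmissible_complete {r : ℕ} {u v a b c : Dir r} (huv : u.1 ≠ v.1) (hab : a.1 ≠ b.1)
    (hac : a.1 ≠ c.1) (hbc : b.1 ≠ c.1) : (LTT.complete u v).IsAdmissible := by
  set G := LTT.complete u v with hG
  let R : Dir r → Dir r → Prop := fun e e' => G.colored.Adj e.bar e'
  have huv' : u ≠ v := Dir.ne_of_fst_ne huv
  have key : ∀ e e', e ≠ u.bar → e' ≠ u → Relation.TransGen R e e' := by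
    intro e e' he he'
    have he₁ : e.bar ≠ u := fun h => he (Dir.bar_eq_iff.1 h)
    by_cases hee : e.bar = e'
    · obtain ⟨f, hf₁, hf₂⟩ : ∃ f : Dir r, f.1 ≠ e.1 ∧ f.1 ≠ u.1 := by
        by_cases h₁ : a.1 ≠ e.1 ∧ a.1 ≠ u.1
        · exact ⟨a, h₁⟩
        by_cases h₂ : b.1 ≠ e.1 ∧ b.1 ≠ u.1
        · exact ⟨b, h₂⟩
        refine ⟨c, ?_, ?_⟩ <;> grind
      refine Relation.TransGen.tail (b := f) (.single ?_) ?_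
      · exact complete_adj_of_ne (Dir.ne_of_fst_ne hf₁.symm) he₁ (Dir.ne_of_fst_ne hf₂)
      · refine complete_adj_of_ne (Dir.ne_of_fst_ne ?_) (Dir.ne_of_fst_ne hf₂) he'
        rw [← hee]
        exact hf₁
    · exact .single (complete_adj_of_ne hee he₁ he')
  have hv : v ≠ u.bar := Dir.ne_of_fst_ne huv.symm
  have hv' : v.bar ≠ u := Dir.ne_of_fst_ne huv.symm
  have hv'' : v.bar ≠ u.bar := Dir.ne_of_fst_ne huv.symm
  have key₂ : ∀ e e', e' ≠ u → Relation.TransGen R e e' := by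
    intro e e' he'
    by_cases he : e = u.bar
    · refine .trans (b := v) (.single ?_) (key v e' hv he')
      change G.colored.Adj _ _
      rw [he, Dir.bar_bar]
      exact complete_adj_red huv'
    · exact key e e' he he'
  have conn : ∀ e e', Relation.TransGen R e e' := by
    intro e e'
    by_cases he' : e' = u
    · refine (key₂ e v.bar hv').tail ?_
      change G.colored.Adj _ _
      rw [he', Dir.bar_bar]
      exact (complete_adj_red huv').symm
    · exact key₂ e e' he'
  have : Nonempty (Dir r) := ⟨u⟩
  obtain ⟨ℓ, h₁, h₂⟩ := exists_birecurrent_walk conn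
  refine ⟨ℓ, h₁, fun i N => ?_, fun d d' hdd' N => ?_⟩
  · obtain ⟨e', he'⟩ : ∃ e', R (i, true) e' := by
      obtain ⟨e', h, -⟩ := (Relation.TransGen.head'_iff).1 (conn (i, true) u)
      exact ⟨e', h⟩
    obtain ⟨⟨n, hn, h, -⟩, ⟨n', hn', h', -⟩⟩ := h₂ _ _ he' N
    exact ⟨⟨n, hn, by rw [h]⟩, ⟨n', hn', by rw [h']⟩⟩
  · have : R d.bar d' := by
      change G.colored.Adj _ _
      rwa [Dir.bar_bar]
    obtain ⟨⟨n, hn, h, h'⟩, ⟨m, hm, k, k'⟩⟩ := h₂ _ _ this N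
    exact ⟨⟨n, hn, by rw [h, h', Dir.bar_bar]⟩, ⟨m, hm, by rw [k, k', Dir.bar_bar]⟩⟩

/-! ### Tightening the image of a smooth path with one further turn -/

section generating

variable {r : ℕ} {g : Fold r} {G G' : LTT r}

lemma Fold.edgeMap_eq_dir_cons (g : Fold r) (d : Dir r) : ∃ t, g.edgeMap d = g.edgeMap.dir d :: t := by
  obtain ⟨e, t, h⟩ := List.exists_cons_of_ne_nil (List.ne_nil_of_mem (g.self_mem_edgeMap d))
  exact ⟨t, by simp [EdgeMap.dir, h]⟩

lemma Fold.flatMap_edgeMap_cons (g : Fold r) (d : Dir r) (w : List (Dir r)) :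
    ∃ t, (d :: w).flatMap g.edgeMap = g.edgeMap.dir d :: t := by
  obtain ⟨t, h⟩ := g.edgeMap_eq_dir_cons d
  exact ⟨t ++ w.flatMap g.edgeMap, by simp [h]⟩

/-- The fold of a generating triple maps smooth paths to smooth paths. -/
lemma IsGeneratingTriple.isSmooth_flatMap (h : IsGeneratingTriple g G G') {w : List (Dir r)}
    (hw : IsSmooth G.colored w) : IsSmooth G'.colored (w.flatMap g.edgeMap) := by
  unfold IsSmooth at *
  rw [List.flatMap, List.isChain_flatten, List.isChain_map]
  · refine ⟨?_, hw.imp fun e e' hee' => ?_⟩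
    · intro l hl
      obtain ⟨d, -, rfl⟩ := List.mem_map.1 hl
      have hadj := h.red_edge.2.2
      by_cases hd : d.1 = g.u.1
      · rcases Dir.eq_or_eq_bar hd with rfl | rfl
        · simpa [g.edgeMap_u] using hadj.symm
        · simpa [g.edgeMap_u_bar] using hadj
      · simp [g.edgeMap_of_fst_ne hd]
    · intro x hx y hy
      obtain ⟨t, ht⟩ := g.edgeMap_eq_dir_cons e.bar
      obtain ⟨t', ht'⟩ := g.edgeMap_eq_dir_cons e'
      rw [← e.bar_bar, g.edgeMap_bar, ht] at hx
      rw [ht'] at hy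
      simp only [invWord_cons, List.getLast?_append, List.getLast?_singleton, Option.some_or,
        Option.mem_def, Option.some.injEq] at hx
      simp only [List.head?_cons, Option.mem_def, Option.some.injEq] at hy
      rw [← hx, ← hy, Dir.bar_bar]
      exact h.induced _ _ hee'
  · simp only [List.mem_map, not_exists, not_and]
    exact fun d _ => List.ne_nil_of_mem (g.self_mem_edgeMap d)

lemma IsSmooth.invWord_append {H : SimpleGraph (Dir r)} {d d' : Dir r} {v w : List (Dir r)}
    (hv : IsSmooth H (d :: v)) (hw : IsSmooth H (d' :: w)) (hdd' : H.Adj d d') :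
    IsSmooth H (_root_.invWord (d :: v) ++ d' :: w) := by
  refine List.IsChain.append hv.invWord hw ?_
  intro x hx y hy
  simp only [invWord_cons, List.getLast?_append, List.getLast?_singleton, Option.some_or,
    Option.mem_def, Option.some.injEq, List.head?_cons] at hx hy
  rw [← hx, ← hy, Dir.bar_bar]
  exact hdd'

variable {H : SimpleGraph (Dir r)} {L : List (Fold r)}

/-- If the fold opens up the turn between two smooth paths, then the images tighten. -/
lemma IsGeneratingTriple.tightensTo (h : IsGeneratingTriple g G G')
    (hL : ∀ w, IsSmooth G'.colored w → IsSmooth H (wordMap L w)) {d d' : Dir r}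
    {v w : List (Dir r)} (hv : IsSmooth G.colored (d :: v)) (hw : IsSmooth G.colored (d' :: w))
    (hdd' : G'.colored.Adj (g.edgeMap.dir d) (g.edgeMap.dir d')) :
    TightensTo H (g :: L) (d :: v) (d' :: w) := by
  refine TightensTo.of_fold (.of_isSmooth (hL _ ?_))
  have hv' := h.isSmooth_flatMap hv
  have hw' := h.isSmooth_flatMap hw
  obtain ⟨t, ht⟩ := g.flatMap_edgeMap_cons d v
  obtain ⟨t', ht'⟩ := g.flatMap_edgeMap_cons d' w
  rw [ht] at hv' ⊢
  rw [ht'] at hw' ⊢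
  exact hv'.invWord_append hw' hdd'

lemma TightensTo.nil_left {w : List (Dir r)} (h : IsSmooth H (wordMap L w)) :
    TightensTo H L [] w :=
  .of_isSmooth (by simpa using h)

lemma TightensTo.nil_right {w : List (Dir r)} (h : IsSmooth H (wordMap L w)) :
    TightensTo H L w [] :=
  (TightensTo.nil_left h).symm

lemma IsSmooth.tail {d : Dir r} {w : List (Dir r)} (h : IsSmooth H (d :: w)) : IsSmooth H w :=
  h.infix (List.suffix_cons d w).isInfix

end generating

/-- If the composition begins with the given five folds, then the image of any concatenation of
two smooth paths tightens to a smooth path. -/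
lemma tightensTo_of_isSmooth {r : ℕ} {x y z w : Dir r} (hxy : x.1 ≠ y.1) (hxz : x.1 ≠ z.1)
    (hxw : x.1 ≠ w.1) (hyz : y.1 ≠ z.1) (hyw : y.1 ≠ w.1) (hzw : z.1 ≠ w.1)
    {g₁ g₂ g₃ g₄ g₅ : Fold r} {M : List (Fold r)} {H : SimpleGraph (Dir r)}
    (hg₁ : g₁ = ⟨z, x, hxz⟩) (hg₂ : g₂ = ⟨w, z, hzw⟩) (hg₃ : g₃ = ⟨y.bar, w, hyw.symm⟩)
    (hg₄ : g₄ = ⟨y.bar, x, hxy⟩) (hg₅ : g₅ = ⟨y.bar, w, hyw.symm⟩)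
    (h₀ : ∀ u, IsSmooth (LTT.complete x y).colored u →
      IsSmooth H (wordMap (g₁ :: g₂ :: g₃ :: g₄ :: g₅ :: M) u))
    (h₁ : ∀ u, IsSmooth (LTT.complete z x.bar).colored u →
      IsSmooth H (wordMap (g₂ :: g₃ :: g₄ :: g₅ :: M) u))
    (h₂ : ∀ u, IsSmooth (LTT.complete w z.bar).colored u →
      IsSmooth H (wordMap (g₃ :: g₄ :: g₅ :: M) u))
    (h₃ : ∀ u, IsSmooth (LTT.complete y.bar w.bar).colored u →
      IsSmooth H (wordMap (g₄ :: g₅ :: M) u))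
    (h₄ : ∀ u, IsSmooth (LTT.complete y.bar x.bar).colored u →
      IsSmooth H (wordMap (g₅ :: M) u))
    (h₅ : ∀ u, IsSmooth (LTT.complete y.bar w.bar).colored u → IsSmooth H (wordMap M u))
    (v v' : List (Dir r)) (hv : IsSmooth (LTT.complete x y).colored v)
    (hv' : IsSmooth (LTT.complete x y).colored v') :
    TightensTo H (g₁ :: g₂ :: g₃ :: g₄ :: g₅ :: M) v v' := by
  have nxy : x ≠ y := Dir.ne_of_fst_ne hxy
  have nxY : x ≠ y.bar := Dir.ne_of_fst_ne hxy
  have nxz : x ≠ z := Dir.ne_of_fst_ne hxz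
  have nxw : x ≠ w := Dir.ne_of_fst_ne hxw
  have nzY : z ≠ y.bar := Dir.ne_of_fst_ne hyz.symm
  have nwY : w ≠ y.bar := Dir.ne_of_fst_ne hyw.symm
  have nzw : z ≠ w := Dir.ne_of_fst_ne hzw
  -- In each triple `l` is the purple end of the red edge of the source structure.
  have t₁ : IsGeneratingTriple g₁ (LTT.complete x y) (LTT.complete z x.bar) := hg₁ ▸
    (isSwitch_complete (⟨z, x, hxz⟩ : Fold r) (l := y) nxy.symm (Dir.ne_of_fst_ne hyz)).1
  have t₂ : IsGeneratingTriple g₂ (LTT.complete z x.bar) (LTT.complete w z.bar) := hg₂ ▸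
    (isSwitch_complete (⟨w, z, hzw⟩ : Fold r) (l := x.bar) (Dir.ne_of_fst_ne hxz) (Dir.ne_of_fst_ne hxw)).1
  have t₃ : IsGeneratingTriple g₃ (LTT.complete w z.bar) (LTT.complete y.bar w.bar) := hg₃ ▸
    (isSwitch_complete (⟨y.bar, w, hyw.symm⟩ : Fold r) (l := z.bar) (Dir.ne_of_fst_ne hzw)
      (Dir.ne_of_fst_ne hyz.symm)).1
  have t₄ : IsGeneratingTriple g₄ (LTT.complete y.bar w.bar) (LTT.complete y.bar x.bar) := hg₄ ▸
    (isExtension_complete (⟨y.bar, x, hxy⟩ : Fold r) (l := w.bar) (Dir.ne_of_fst_ne hxw.symm)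
      (Dir.ne_of_fst_ne hyw.symm)).1
  have t₅ : IsGeneratingTriple g₅ (LTT.complete y.bar x.bar) (LTT.complete y.bar w.bar) := hg₅ ▸
    (isExtension_complete (⟨y.bar, w, hyw.symm⟩ : Fold r) (l := x.bar) (Dir.ne_of_fst_ne hxw)
      (Dir.ne_of_fst_ne hxy)).1
  have d₁ : ∀ d, d ≠ z → g₁.edgeMap.dir d = d := fun d h => g₁.dir_of_ne (by rwa [hg₁])
  have d₁z : g₁.edgeMap.dir z = x := by subst hg₁; exact Fold.dir_u _
  have d₂ : ∀ d, d ≠ w → g₂.edgeMap.dir d = d := fun d h => g₂.dir_of_ne (by rwa [hg₂])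
  have d₂w : g₂.edgeMap.dir w = z := by subst hg₂; exact Fold.dir_u _
  have d₃ : ∀ d, d ≠ y.bar → g₃.edgeMap.dir d = d := fun d h => g₃.dir_of_ne (by rwa [hg₃])
  have d₃y : g₃.edgeMap.dir y.bar = w := by subst hg₃; exact Fold.dir_u _
  have d₄ : ∀ d, d ≠ y.bar → g₄.edgeMap.dir d = d := fun d h => g₄.dir_of_ne (by rwa [hg₄])
  have d₄y : g₄.edgeMap.dir y.bar = x := by subst hg₄; exact Fold.dir_u _
  have d₅ : ∀ d, d ≠ y.bar → g₅.edgeMap.dir d = d := fun d h => g₅.dir_of_ne (by rwa [hg₅])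
  have d₅y : g₅.edgeMap.dir y.bar = w := by subst hg₅; exact Fold.dir_u _
  have e₁ : ∀ d u, d.1 ≠ z.1 → (d :: u).flatMap g₁.edgeMap = d :: u.flatMap g₁.edgeMap := by
    intro d u h
    rw [List.flatMap_cons, g₁.edgeMap_of_fst_ne (by rwa [hg₁]), List.singleton_append]
  have e₂ : ∀ d u, d.1 ≠ w.1 → (d :: u).flatMap g₂.edgeMap = d :: u.flatMap g₂.edgeMap := by
    intro d u h
    rw [List.flatMap_cons, g₂.edgeMap_of_fst_ne (by rwa [hg₂]), List.singleton_append]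
  have e₃ : ∀ d u, d.1 ≠ y.1 → (d :: u).flatMap g₃.edgeMap = d :: u.flatMap g₃.edgeMap := by
    intro d u h
    rw [List.flatMap_cons, g₃.edgeMap_of_fst_ne (by rwa [hg₃]), List.singleton_append]
  have e₄ : ∀ d u, d.1 ≠ y.1 → (d :: u).flatMap g₄.edgeMap = d :: u.flatMap g₄.edgeMap := by
    intro d u h
    rw [List.flatMap_cons, g₄.edgeMap_of_fst_ne (by rwa [hg₄]), List.singleton_append]
  have e₁z : ∀ u, (z :: u).flatMap g₁.edgeMap = x :: z :: u.flatMap g₁.edgeMap := by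
    intro u; subst hg₁; rw [List.flatMap_cons, Fold.edgeMap_u ⟨z, x, hxz⟩]; rfl
  have e₂w : ∀ u, (w :: u).flatMap g₂.edgeMap = z :: w :: u.flatMap g₂.edgeMap := by
    intro u; subst hg₂; rw [List.flatMap_cons, Fold.edgeMap_u ⟨w, z, hzw⟩]; rfl
  have e₃y : ∀ u, (y.bar :: u).flatMap g₃.edgeMap = w :: y.bar :: u.flatMap g₃.edgeMap := by
    intro u; subst hg₃; rw [List.flatMap_cons, Fold.edgeMap_u ⟨y.bar, w, hyw.symm⟩]; rfl
  have e₄y : ∀ u, (y.bar :: u).flatMap g₄.edgeMap = x :: y.bar :: u.flatMap g₄.edgeMap := by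
    intro u; subst hg₄; rw [List.flatMap_cons, Fold.edgeMap_u ⟨y.bar, x, hxy⟩]; rfl
  -- two smooth paths that begin with `x w` and `z ybar`
  have main : ∀ u u', IsSmooth (LTT.complete x y).colored (x :: w :: u) →
      IsSmooth (LTT.complete x y).colored (z :: y.bar :: u') →
      TightensTo H (g₁ :: g₂ :: g₃ :: g₄ :: g₅ :: M) (x :: w :: u) (z :: y.bar :: u') := by
    intro u u' hu hu'
    have s₁ := t₁.isSmooth_flatMap hu
    have s₁' := t₁.isSmooth_flatMap hu'
    refine .of_fold ?_
    rw [e₁ _ _ hxz, e₁ _ _ hzw.symm] at s₁ ⊢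
    rw [e₁z, e₁ _ _ (by simpa using hyz)] at s₁' ⊢
    -- The common `x` cancels; the next fold turns `w` into `z w`, so a `z` will cancel as well.
    refine .cons x (.of_fold ?_)
    replace s₁ := t₂.isSmooth_flatMap s₁.tail
    replace s₁' := t₂.isSmooth_flatMap s₁'.tail
    rw [e₂w] at s₁ ⊢
    rw [e₂ _ _ hzw, e₂ _ _ (by simpa using hyw)] at s₁' ⊢
    refine .cons z (.of_fold ?_)
    replace s₁ := t₃.isSmooth_flatMap s₁.tail
    replace s₁' := t₃.isSmooth_flatMap s₁'.tail
    rw [e₃ _ _ hyw.symm] at s₁ ⊢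
    rw [e₃y] at s₁' ⊢
    refine .cons w ?_
    replace s₁ := s₁.tail
    replace s₁' := s₁'.tail
    rcases u with - | ⟨d, u⟩
    · exact .nil_left (h₃ _ s₁')
    -- In `G_0` the red vertex `x` is adjacent only to `y`, so the smooth path cannot pass from `w`
    -- to `x`.
    have hd : d ≠ x := by
      rintro rfl
      have := hu.tail
      simp only [IsSmooth, List.isChain_cons_cons, LTT.complete_adj] at this
      have hwx : w.bar ≠ y := Dir.ne_of_fst_ne hyw.symm
      have hwx' : w.bar ≠ d := Dir.ne_of_fst_ne hxw.symm
      tauto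
    -- Besides `x` itself, only `z` is sent to the direction `x` by the first three folds. In that
    -- case the fourth fold creates one more common `x`, and the fifth sends the remaining
    -- directions to `z` and `w`.
    by_cases hdz : d = z
    · subst hdz
      rw [e₁z, e₂ _ _ hxw, e₂ _ _ hzw, e₃ _ _ hxy, e₃ _ _ hyz.symm] at s₁ ⊢
      refine .of_fold ?_
      replace s₁ := t₄.isSmooth_flatMap s₁
      replace s₁' := t₄.isSmooth_flatMap s₁'
      rw [e₄ _ _ hxy, e₄ _ _ hyz.symm] at s₁ ⊢
      rw [e₄y] at s₁' ⊢
      refine .cons x (t₅.tightensTo h₅ s₁.tail s₁'.tail ?_)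
      rw [d₅ _ nzY, d₅y]
      exact LTT.complete_adj_of_ne nzw nzY nwY
    · obtain ⟨u₁, hu₁⟩ := g₁.flatMap_edgeMap_cons d u
      obtain ⟨u₂, hu₂⟩ := g₂.flatMap_edgeMap_cons (g₁.edgeMap.dir d) u₁
      obtain ⟨u₃, hu₃⟩ := g₃.flatMap_edgeMap_cons (g₂.edgeMap.dir (g₁.edgeMap.dir d)) u₂
      rw [hu₁, hu₂, hu₃, d₁ _ hdz] at s₁ ⊢
      -- With `x` and `z` excluded, `x` has no preimage left, and `y.bar` is missed by the direction
      -- map of the third fold. So the fourth fold separates this direction from `y.bar`.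
      obtain ⟨hx, hy⟩ : g₃.edgeMap.dir (g₂.edgeMap.dir d) ≠ x ∧
          g₃.edgeMap.dir (g₂.edgeMap.dir d) ≠ y.bar := by
        by_cases hdw : d = w
        · rw [hdw, d₂w, d₃ _ nzY]
          exact ⟨nxz.symm, nzY⟩
        · rw [d₂ _ hdw]
          by_cases hdy : d = y.bar
          · rw [hdy, d₃y]
            exact ⟨nxw.symm, nwY⟩
          · rw [d₃ _ hdy]
            exact ⟨hd, hdy⟩
      refine t₄.tightensTo h₄ s₁ s₁' ?_
      rw [d₄ _ hy, d₄y]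
      exact LTT.complete_adj_of_ne hx hy nxY
  -- two smooth paths that begin with `x` and `z`
  have main₂ : ∀ u u', IsSmooth (LTT.complete x y).colored (x :: u) →
      IsSmooth (LTT.complete x y).colored (z :: u') →
      TightensTo H (g₁ :: g₂ :: g₃ :: g₄ :: g₅ :: M) (x :: u) (z :: u') := by
    intro u u' hu hu'
    by_cases hw : ∃ u₁, u = w :: u₁
    · obtain ⟨u₁, rfl⟩ := hw
      by_cases hy : ∃ u₂, u' = y.bar :: u₂
      · obtain ⟨u₂, rfl⟩ := hy
        exact main _ _ hu hu'
      · have s₁ := t₁.isSmooth_flatMap hu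
        have s₁' := t₁.isSmooth_flatMap hu'
        refine .of_fold ?_
        rw [e₁ _ _ hxz, e₁ _ _ hzw.symm] at s₁ ⊢
        rw [e₁z] at s₁' ⊢
        refine .cons x (.of_fold ?_)
        replace s₁ := t₂.isSmooth_flatMap s₁.tail
        replace s₁' := t₂.isSmooth_flatMap s₁'.tail
        rw [e₂w] at s₁ ⊢
        rw [e₂ _ _ hzw] at s₁' ⊢
        refine .cons z ?_
        replace s₁ := s₁.tail
        replace s₁' := s₁'.tail
        rcases u' with - | ⟨d, u'⟩
        · exact .nil_right (h₂ _ s₁)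
        have hdy : d ≠ y.bar := fun h => hy ⟨u', by rw [h]⟩
        obtain ⟨v₁, hv₁⟩ := g₁.flatMap_edgeMap_cons d u'
        obtain ⟨v₂, hv₂⟩ := g₂.flatMap_edgeMap_cons (g₁.edgeMap.dir d) v₁
        rw [hv₁, hv₂] at s₁' ⊢
        -- The second fold misses the direction `w`, and `y.bar` could only come from itself.
        obtain ⟨hw, hy⟩ : g₂.edgeMap.dir (g₁.edgeMap.dir d) ≠ w ∧
            g₂.edgeMap.dir (g₁.edgeMap.dir d) ≠ y.bar := by
          by_cases hdz : d = z
          · rw [hdz, d₁z, d₂ _ nxw]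
            exact ⟨nxw, nxY⟩
          · rw [d₁ _ hdz]
            by_cases hdw : d = w
            · rw [hdw, d₂w]
              exact ⟨nzw, nzY⟩
            · rw [d₂ _ hdw]
              exact ⟨hdw, hdy⟩
        refine t₃.tightensTo h₃ s₁ s₁' ?_
        rw [d₃ _ nwY, d₃ _ hy]
        exact LTT.complete_adj_of_ne hw.symm nwY hy
    · have s₁ := t₁.isSmooth_flatMap hu
      have s₁' := t₁.isSmooth_flatMap hu'
      refine .of_fold ?_
      rw [e₁ _ _ hxz] at s₁ ⊢
      rw [e₁z] at s₁' ⊢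
      refine .cons x ?_
      replace s₁ := s₁.tail
      replace s₁' := s₁'.tail
      rcases u with - | ⟨d, u⟩
      · exact .nil_left (h₁ _ s₁')
      have hdw : d ≠ w := fun h => hw ⟨u, by rw [h]⟩
      obtain ⟨v₁, hv₁⟩ := g₁.flatMap_edgeMap_cons d u
      rw [hv₁] at s₁ ⊢
      -- The first fold misses the direction `z`, and `w` could only come from itself.
      obtain ⟨hw, hz⟩ : g₁.edgeMap.dir d ≠ w ∧ g₁.edgeMap.dir d ≠ z := by
        by_cases hdz : d = z
        · rw [hdz, d₁z]
          exact ⟨nxw, nxz⟩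
        · rw [d₁ _ hdz]
          exact ⟨hdw, hdz⟩
      refine t₂.tightensTo h₂ s₁ s₁' ?_
      rw [d₂ _ hw, d₂ _ nzw]
      exact LTT.complete_adj_of_ne hz hw nzw
  -- two smooth paths that begin with `x` and another direction
  have main₃ : ∀ d u u', d ≠ x → IsSmooth (LTT.complete x y).colored (x :: u) →
      IsSmooth (LTT.complete x y).colored (d :: u') →
      TightensTo H (g₁ :: g₂ :: g₃ :: g₄ :: g₅ :: M) (x :: u) (d :: u') := by
    intro d u u' hd hu hu'
    by_cases hdz : d = z
    · subst hdz
      exact main₂ u u' hu hu'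
    · refine t₁.tightensTo h₁ hu hu' ?_
      rw [d₁ _ hdz, d₁ _ nxz]
      exact LTT.complete_adj_of_ne hd.symm nxz hdz
  -- Strip the common initial letters; at the first difference, a turn not involving `x` already
  -- lies in `G_0`.
  induction v generalizing v' with
  | nil => exact .nil_left (h₀ _ hv')
  | cons d v ih =>
    rcases v' with - | ⟨d', v'⟩
    · exact .nil_right (h₀ _ hv)
    by_cases hdd' : d = d'
    · subst hdd'
      exact .cons d (ih v' hv.tail hv'.tail)
    by_cases hd : d = x
    · subst hd
      exact main₃ d' v v' (Ne.symm hdd') hv hv'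
    by_cases hd' : d' = x
    · subst hd'
      exact (main₃ d v' v hdd' hv' hv).symm
    · exact .of_isSmooth (h₀ _ (hv.invWord_append hv' (LTT.complete_adj_of_ne hdd' hd hd')))

open scoped unitInterval

/-! ### Straight segments in the rose -/

namespace Rose

variable {r : ℕ}

/-- The oriented edge `d`, parametrized by `[0, 1]` and extended by constants to the real line. -/
noncomputable def edge (d : Dir r) : C(ℝ, Rose r) := (edgePath d).extend

lemma edge_coe (d : Dir r) (t : I) : edge d t = edgePath d t := Path.extend_extends' _ t

@[simp] lemma edge_zero (d : Dir r) : edge d 0 = vertex r := Path.extend_zero _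

@[simp] lemma edge_one (d : Dir r) : edge d 1 = vertex r := Path.extend_one _

lemma edgePath_bar (d : Dir r) : edgePath d.bar = (edgePath d).symm := by
  obtain ⟨i, b⟩ := d
  cases b <;> simp [edgePath, Dir.bar]

lemma edge_bar (d : Dir r) (t : ℝ) : edge d.bar t = edge d (1 - t) := by
  rw [edge, edgePath_bar, Path.extend_symm_apply, edge]

lemma edge_of_le {d : Dir r} {t : ℝ} (ht : t ≤ 0) : edge d t = vertex r :=
  Path.extend_of_le_zero _ ht

lemma edge_of_ge {d : Dir r} {t : ℝ} (ht : 1 ≤ t) : edge d t = vertex r :=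
  Path.extend_of_one_le _ ht

lemma exists_eq_edge (p : Rose r) : p = vertex r ∨ ∃ i, ∃ t : I, p = edge (i, true) t := by
  obtain ⟨x⟩ := p
  rcases x with _ | ⟨i, t⟩
  · exact Or.inl rfl
  · exact Or.inr ⟨i, t, by rw [edge_coe]; rfl⟩

lemma mapOfLoops_edge (γ : Fin r → Path (vertex r) (vertex r)) (i : Fin r) (t : ℝ) :
    mapOfLoops γ (edge (i, true) t) = (γ i).extend t := by
  rcases le_total t 0 with h | h
  · rw [edge_of_le h, Path.extend_of_le_zero _ h]
    rfl
  rcases le_total 1 t with h' | h'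
  · rw [edge_of_ge h', Path.extend_of_one_le _ h']
    rfl
  · rw [edge_coe (i, true) ⟨t, h, h'⟩, Path.extend_apply _ ⟨h, h'⟩]
    rfl

end Rose

namespace Fold

variable {r : ℕ} (g : Fold r)

open Rose

lemma toMap_edge_of_fst_ne {d : Dir r} (h : d.1 ≠ g.u.1) (t : ℝ) :
    g.toMap (edge d t) = edge d t := by
  have key : ∀ t, g.toMap (edge (d.1, true) t) = edge (d.1, true) t := by
    intro t
    rw [toMap, mapOfLoops_edge, g.edgeMap_of_fst_ne (d := (d.1, true)) h]
    rfl
  rcases Dir.eq_or_eq_bar (d := d) (e := (d.1, true)) rfl with h | h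
  · rw [h, key]
  · rw [h, edge_bar, key]

lemma toMap_edge_of_eq_pair {d e₁ e₂ : Dir r} (h : g.edgeMap d = [e₁, e₂]) (t : ℝ) :
    g.toMap (edge d t) = if t ≤ 1 / 2 then edge e₁ (2 * t) else edge e₂ (2 * t - 1) := by
  have key : ∀ {i e₁ e₂}, g.edgeMap (i, true) = [e₁, e₂] → ∀ t, g.toMap (edge (i, true) t) =
      if t ≤ 1 / 2 then edge e₁ (2 * t) else edge e₂ (2 * t - 1) := by
    intro i e₁ e₂ h t
    rw [toMap, mapOfLoops_edge, h]
    change ((edgePath e₁).trans (edgePath e₂)).extend t = _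
    split_ifs with ht
    · exact Path.extend_trans_of_le_half _ _ ht
    · exact Path.extend_trans_of_half_le _ _ (le_of_not_ge ht)
  obtain ⟨i, b⟩ := d
  cases b
  · have h' : g.edgeMap (i, true) = [e₂.bar, e₁.bar] := by
      have := g.edgeMap_bar (i, false)
      rw [h] at this
      simpa [Dir.bar] using this
    rw [show ((i, false) : Dir r) = Dir.bar (i, true) from rfl, edge_bar, key h', edge_bar, edge_bar]
    split_ifs with h₁ h₂ h₂
    -- The formulas for the two halves overlap only at the midpoint, where both give the vertex.
    · rw [show t = 1 / 2 by linarith]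
      norm_num
    · congr 1
      ring
    · congr 1
      ring
    · linarith
  · exact key h t

lemma edgeMap_eq_pair_of_fst_eq {d : Dir r} (h : d.1 = g.u.1) :
    ∃ e₁ e₂, g.edgeMap d = [e₁, e₂] := by
  rcases Dir.eq_or_eq_bar h with rfl | rfl
  exacts [⟨_, _, g.edgeMap_u⟩, ⟨_, _, g.edgeMap_u_bar⟩]

end Fold

/-! ### Groupoid identities for homotopy classes of paths. -/

namespace Path.Homotopic.Quotient

variable {X : Type*} [TopologicalSpace X] {x y z : X}

lemma symm_symm (α : Homotopic.Quotient x y) : α.symm.symm = α := by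
  induction α using Quotient.ind with | mk a =>
  rw [← mk_symm, ← mk_symm, Path.symm_symm]

lemma symm_of_trans (α : Homotopic.Quotient x y) (β : Homotopic.Quotient y z) :
    (α.trans β).symm = β.symm.trans α.symm := by
  induction α using Quotient.ind with | mk a =>
  induction β using Quotient.ind with | mk b =>
  rw [← mk_symm, ← mk_symm, ← mk_trans, ← mk_trans, ← mk_symm, Path.trans_symm]

lemma symm_refl : (refl x).symm = refl x := by
  rw [← mk_refl, ← mk_symm, Path.refl_symm]

lemma map_trans {Y : Type*} [TopologicalSpace Y] (α : Homotopic.Quotient x y)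
    (β : Homotopic.Quotient y z) (f : C(X, Y)) :
    (α.trans β).map f = (α.map f).trans (β.map f) := by
  induction α using Quotient.ind with | mk a =>
  induction β using Quotient.ind with | mk b =>
  rw [← mk_trans, ← mk_map, ← mk_map, ← mk_map, ← mk_trans, Path.map_trans]

end Path.Homotopic.Quotient

open Path

/-- The homotopy class of a path that runs along the oriented edge `d` from the point with
parameter `s` to the point with parameter `t`. -/
def IsSeg {r : ℕ} (d : Dir r) (s t : ℝ) {p q : Rose r} (α : Homotopic.Quotient p q) : Prop :=
  ∃ (c : Path s t) (ρ : Path p q), Homotopic.Quotient.mk ρ = α ∧ ∀ τ, ρ τ = Rose.edge d (c τ)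

namespace IsSeg

variable {r : ℕ} {d : Dir r} {s t u : ℝ} {p q m : Rose r} {α : Homotopic.Quotient p q}

lemma source (h : IsSeg d s t α) : p = Rose.edge d s := by
  obtain ⟨c, ρ, -, h⟩ := h
  simpa using h 0

lemma target (h : IsSeg d s t α) : q = Rose.edge d t := by
  obtain ⟨c, ρ, -, h⟩ := h
  simpa using h 1

lemma of_curve (c : Path s t) (ρ : Path p q) (h : ∀ τ, ρ τ = Rose.edge d (c τ)) :
    IsSeg d s t (Homotopic.Quotient.mk ρ) := ⟨c, ρ, rfl, h⟩

/-- The real line is simply connected, so the class depends only on the end parameters, and any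
convenient parameter curve may be used. -/
lemma exists_curve (h : IsSeg d s t α) (c : Path s t) :
    ∃ ρ : Path p q, Homotopic.Quotient.mk ρ = α ∧ ∀ τ, ρ τ = Rose.edge d (c τ) := by
  obtain ⟨c', ρ, rfl, h⟩ := h
  have hp : p = Rose.edge d s := by simpa using h 0
  have hq : q = Rose.edge d t := by simpa using h 1
  subst hp hq
  refine ⟨c.map (Rose.edge d).continuous, ?_, fun τ => rfl⟩
  have : ρ = c'.map (Rose.edge d).continuous := Path.ext (funext h)
  rw [this, Homotopic.Quotient.eq]
  exact (SimplyConnectedSpace.paths_homotopic c c').map (Rose.edge d)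

lemma unique {β : Homotopic.Quotient p q} (h : IsSeg d s t α) (h' : IsSeg d s t β) : α = β := by
  obtain ⟨c, ρ, rfl, h⟩ := h
  obtain ⟨ρ', rfl, hρ'⟩ := h'.exists_curve c
  rw [show ρ = ρ' from Path.ext (funext fun τ => (h τ).trans (hρ' τ).symm)]

lemma exists_isSeg (d : Dir r) (s t : ℝ) :
    ∃ α : Homotopic.Quotient (Rose.edge d s) (Rose.edge d t), IsSeg d s t α :=
  ⟨_, of_curve (PathConnectedSpace.somePath s t) (Path.map _ (Rose.edge d).continuous) fun _ => rfl⟩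

lemma symm (h : IsSeg d s t α) : IsSeg d t s α.symm := by
  obtain ⟨c, ρ, rfl, h⟩ := h
  exact of_curve c.symm ρ.symm fun τ => h _

lemma trans {β : Homotopic.Quotient q m} (h : IsSeg d s t α) (h' : IsSeg d t u β) :
    IsSeg d s u (α.trans β) := by
  obtain ⟨c, ρ, rfl, h⟩ := h
  obtain ⟨c', ρ', rfl, h'⟩ := h'
  refine of_curve (c.trans c') (ρ.trans ρ') fun τ => ?_
  rw [Path.trans_apply, Path.trans_apply]
  split_ifs <;> simp [h, h']

lemma bar (h : IsSeg d s t α) : IsSeg d.bar (1 - s) (1 - t) α := by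
  obtain ⟨c, ρ, rfl, h⟩ := h
  refine of_curve (c.map (f := fun a => 1 - a) (by fun_prop)) ρ fun τ => ?_
  rw [Rose.edge_bar, h]
  simp

lemma bar_symm (h : IsSeg d s t α) : IsSeg d.bar (1 - t) (1 - s) α.symm := h.symm.bar

lemma isSeg_refl (d : Dir r) (s : ℝ) : IsSeg d s s (Homotopic.Quotient.refl (Rose.edge d s)) :=
  of_curve (Path.refl s) (Path.refl _) fun _ => rfl

lemma map_of_fst_ne {g : Fold r} (h : IsSeg d s t α) (hd : d.1 ≠ g.u.1) :
    IsSeg d s t (α.map g.toMap) := by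
  obtain ⟨c, ρ, rfl, h⟩ := h
  refine of_curve c (ρ.map g.toMap.continuous) fun τ => ?_
  rw [Path.map_coe, Function.comp_apply, h, g.toMap_edge_of_fst_ne hd]

lemma map_first {g : Fold r} {e₁ e₂ : Dir r} (h : IsSeg d s t α) (hd : g.edgeMap d = [e₁, e₂])
    (hs : s ≤ 1 / 2) (ht : t ≤ 1 / 2) : IsSeg e₁ (2 * s) (2 * t) (α.map g.toMap) := by
  obtain ⟨ρ, rfl, hρ⟩ := h.exists_curve (Path.segment s t)
  -- The straight parameter curve never leaves the first half, so a single formula for the fold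
  -- applies throughout.
  refine of_curve ((Path.segment s t).map (f := fun a => 2 * a) (by fun_prop))
    (ρ.map g.toMap.continuous) fun τ => ?_
  rw [Path.map_coe, Function.comp_apply, hρ, g.toMap_edge_of_eq_pair hd, if_pos]
  · rfl
  · have := τ.2.1
    have := τ.2.2
    simp [AffineMap.lineMap_apply]
    nlinarith

lemma map_second {g : Fold r} {e₁ e₂ : Dir r} (h : IsSeg d s t α) (hd : g.edgeMap d = [e₁, e₂])
    (hs : 1 / 2 ≤ s) (ht : 1 / 2 ≤ t) : IsSeg e₂ (2 * s - 1) (2 * t - 1) (α.map g.toMap) := by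
  have hd' : g.edgeMap d.bar = [e₂.bar, e₁.bar] := by simp [g.edgeMap_bar, hd]
  have := (h.bar.map_first hd' (by linarith) (by linarith)).bar
  rw [Dir.bar_bar] at this
  convert this using 1 <;> ring

end IsSeg

/-! ### Paths made of straight pieces -/

/-- A straight piece of path, running along the oriented edge `d` from the parameter `s` to the
parameter `t`. -/
structure Piece (r : ℕ) where
  d : Dir r
  s : ℝ
  t : ℝ

namespace Piece

variable {r : ℕ}

/-- The piece is nondegenerate and runs forwards. -/
def Ok (p : Piece r) : Prop := 0 ≤ p.s ∧ p.s < p.t ∧ p.t ≤ 1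

/-- The first piece runs up to the vertex and the second one starts there. -/
def Linked (p q : Piece r) : Prop := p.t = 1 ∧ q.s = 0

/-- The piece run backwards. -/
def bar (p : Piece r) : Piece r := ⟨p.d.bar, 1 - p.t, 1 - p.s⟩

lemma Ok.bar {p : Piece r} (h : p.Ok) : p.bar.Ok := by
  obtain ⟨h₀, h₁, h₂⟩ := h
  refine ⟨?_, ?_, ?_⟩ <;> simp only [Piece.bar] <;> linarith

lemma Linked.bar {p q : Piece r} (h : p.Linked q) : q.bar.Linked p.bar := by
  simp [Linked, Piece.bar, h.1, h.2]

end Piece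

section pieces

variable {r : ℕ}

/-- A sequence of nondegenerate pieces that only change edges at the vertex. -/
def IsLinked (ps : List (Piece r)) : Prop := (∀ p ∈ ps, p.Ok) ∧ ps.IsChain Piece.Linked

/-- The sequence of edges through which the pieces run. -/
def word (ps : List (Piece r)) : List (Dir r) := ps.map Piece.d

/-- The pieces run backwards. -/
def invPieces (ps : List (Piece r)) : List (Piece r) := (ps.map Piece.bar).reverse

/-- The sum of the lengths of the pieces, each edge having length one. -/
def totalLength (ps : List (Piece r)) : ℝ := (ps.map fun p => p.t - p.s).sum

@[simp] lemma word_nil : word ([] : List (Piece r)) = [] := rfl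

@[simp] lemma word_cons (p : Piece r) (ps : List (Piece r)) : word (p :: ps) = p.d :: word ps := rfl

@[simp] lemma word_append (ps qs : List (Piece r)) : word (ps ++ qs) = word ps ++ word qs := by
  simp [word]

@[simp] lemma invPieces_nil : invPieces ([] : List (Piece r)) = [] := rfl

@[simp] lemma invPieces_cons (p : Piece r) (ps : List (Piece r)) :
    invPieces (p :: ps) = invPieces ps ++ [p.bar] := by
  simp [invPieces]

@[simp] lemma word_invPieces (ps : List (Piece r)) : word (invPieces ps) = invWord (word ps) := by
  induction ps with
  | nil => rfl
  | cons p ps ih => simp [ih, Piece.bar]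

lemma IsLinked.nil : IsLinked ([] : List (Piece r)) := ⟨by simp, by simp⟩

lemma IsLinked.tail {p : Piece r} {ps : List (Piece r)} (h : IsLinked (p :: ps)) : IsLinked ps :=
  ⟨fun q hq => h.1 q (List.mem_cons_of_mem _ hq), h.2.of_cons⟩

lemma IsLinked.head {p : Piece r} {ps : List (Piece r)} (h : IsLinked (p :: ps)) : p.Ok :=
  h.1 p List.mem_cons_self

lemma IsLinked.inv {ps : List (Piece r)} (h : IsLinked ps) : IsLinked (invPieces ps) := by
  refine ⟨?_, ?_⟩
  · intro p hp
    simp only [invPieces, List.mem_reverse, List.mem_map] at hp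
    obtain ⟨q, hq, rfl⟩ := hp
    exact (h.1 q hq).bar
  · unfold invPieces
    rw [List.isChain_reverse, List.isChain_map]
    exact h.2.imp fun a b hab => hab.bar

lemma IsLinked.append {ps qs : List (Piece r)} (hp : IsLinked ps) (hq : IsLinked qs)
    (h : ∀ p ∈ ps.getLast?, ∀ q ∈ qs.head?, p.Linked q) : IsLinked (ps ++ qs) :=
  ⟨fun p hp' => (List.mem_append.1 hp').elim (hp.1 p) (hq.1 p), List.IsChain.append hp.2 hq.2 h⟩

lemma IsLinked.cons {p : Piece r} {qs : List (Piece r)} (hp : p.Ok) (hq : IsLinked qs)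
    (h : ∀ q ∈ qs.head?, p.Linked q) : IsLinked (p :: qs) := by
  refine IsLinked.append (ps := [p]) ⟨by simpa using hp, by simp⟩ hq ?_
  simpa using h

lemma IsLinked.link {p : Piece r} {qs : List (Piece r)} (h : IsLinked (p :: qs)) :
    ∀ q ∈ qs.head?, p.Linked q := by
  rcases qs with - | ⟨q, qs⟩
  · simp
  · simpa using (List.isChain_cons_cons.1 h.2).1

@[simp] lemma totalLength_nil : totalLength ([] : List (Piece r)) = 0 := rfl

@[simp] lemma totalLength_cons (p : Piece r) (ps : List (Piece r)) :
    totalLength (p :: ps) = (p.t - p.s) + totalLength ps := by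
  simp [totalLength]

@[simp] lemma totalLength_append (ps qs : List (Piece r)) :
    totalLength (ps ++ qs) = totalLength ps + totalLength qs := by
  simp [totalLength]

lemma IsLinked.totalLength_le {ps : List (Piece r)} (h : ∀ p ∈ ps, p.Ok) :
    totalLength ps ≤ ps.length := by
  induction ps with
  | nil => simp
  | cons p ps ih =>
    have := ih fun q hq => h q (List.mem_cons_of_mem _ hq)
    obtain ⟨h₀, -, h₁⟩ := h p List.mem_cons_self
    rw [totalLength_cons, List.length_cons]
    push_cast
    linarith

end pieces

/-! ### The action of folds on pieces -/

/-- The pieces of the image of a piece of an edge that is mapped to the edge path `e₁ e₂`. -/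
noncomputable def splitPiece {r : ℕ} (e₁ e₂ : Dir r) (s t : ℝ) : List (Piece r) :=
  if t ≤ 1 / 2 then [⟨e₁, 2 * s, 2 * t⟩]
  else if 1 / 2 ≤ s then [⟨e₂, 2 * s - 1, 2 * t - 1⟩]
  else [⟨e₁, 2 * s, 1⟩, ⟨e₂, 0, 2 * t - 1⟩]

/-- The pieces of the image of a piece under a fold. -/
noncomputable def Fold.pieceMap {r : ℕ} (g : Fold r) (p : Piece r) : List (Piece r) :=
  match g.edgeMap p.d with
  | [e₁, e₂] => splitPiece e₁ e₂ p.s p.t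
  | _ => [p]

/-- The pieces of the image of a sequence of pieces under a composition of folds. -/
noncomputable def piecesMap {r : ℕ} : List (Fold r) → List (Piece r) → List (Piece r)
  | [], ps => ps
  | g :: L, ps => piecesMap L (ps.flatMap g.pieceMap)

namespace Fold

variable {r : ℕ} (g : Fold r) {p : Piece r}

lemma pieceMap_cases :
    (p.d.1 ≠ g.u.1 ∧ g.edgeMap p.d = [p.d] ∧ g.pieceMap p = [p]) ∨
    (p.d.1 = g.u.1 ∧ ∃ e₁ e₂, g.edgeMap p.d = [e₁, e₂] ∧
      ((p.t ≤ 1 / 2 ∧ g.pieceMap p = [⟨e₁, 2 * p.s, 2 * p.t⟩]) ∨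
       (1 / 2 ≤ p.s ∧ g.pieceMap p = [⟨e₂, 2 * p.s - 1, 2 * p.t - 1⟩]) ∨
       (p.s < 1 / 2 ∧ 1 / 2 < p.t ∧
        g.pieceMap p = [⟨e₁, 2 * p.s, 1⟩, ⟨e₂, 0, 2 * p.t - 1⟩]))) := by
  by_cases hd : p.d.1 = g.u.1
  · obtain ⟨e₁, e₂, he⟩ := g.edgeMap_eq_pair_of_fst_eq hd
    have hg : g.pieceMap p = splitPiece e₁ e₂ p.s p.t := by simp [pieceMap, he]
    refine Or.inr ⟨hd, e₁, e₂, he, ?_⟩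
    rw [hg, splitPiece]
    split_ifs with h₁ h₂
    · exact Or.inl ⟨h₁, rfl⟩
    · exact Or.inr (Or.inl ⟨h₂, rfl⟩)
    · exact Or.inr (Or.inr ⟨lt_of_not_ge h₂, lt_of_not_ge h₁, rfl⟩)
  · have he := g.edgeMap_of_fst_ne hd
    exact Or.inl ⟨hd, he, by simp [pieceMap, he]⟩

lemma pieceMap_ne_nil : g.pieceMap p ≠ [] := by
  rcases g.pieceMap_cases (p := p) with ⟨-, -, h'⟩ |
    ⟨-, e₁, e₂, -, ⟨-, h'⟩ | ⟨-, h'⟩ | ⟨-, -, h'⟩⟩ <;> simp [h']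

lemma isLinked_pieceMap (h : p.Ok) : IsLinked (g.pieceMap p) := by
  have h₀ := h.1
  have h₁ := h.2.1
  have h₂ := h.2.2
  rcases g.pieceMap_cases (p := p) with ⟨-, -, h'⟩ |
    ⟨-, e₁, e₂, -, ⟨h₃, h'⟩ | ⟨h₃, h'⟩ | ⟨h₃, h₄, h'⟩⟩ <;> rw [h'] <;>
    refine ⟨fun q hq => ?_, by simp [Piece.Linked]⟩ <;>
    simp only [List.mem_cons, List.not_mem_nil, or_false] at hq
  · rwa [hq]
  · subst hq
    refine ⟨?_, ?_, ?_⟩ <;> dsimp only <;> linarith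
  · subst hq
    refine ⟨?_, ?_, ?_⟩ <;> dsimp only <;> linarith
  · rcases hq with rfl | rfl <;> refine ⟨?_, ?_, ?_⟩ <;> dsimp only <;> linarith

lemma pieceMap_head (hs : p.s = 0) : ∀ q ∈ (g.pieceMap p).head?, q.s = 0 := by
  rcases g.pieceMap_cases (p := p) with ⟨-, -, h'⟩ |
    ⟨-, e₁, e₂, -, ⟨h₃, h'⟩ | ⟨h₃, h'⟩ | ⟨h₃, h₄, h'⟩⟩ <;> simp [h', hs]
  · norm_num [hs] at h₃

lemma pieceMap_last (ht : p.t = 1) : ∀ q ∈ (g.pieceMap p).getLast?, q.t = 1 := by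
  rcases g.pieceMap_cases (p := p) with ⟨-, -, h'⟩ |
    ⟨-, e₁, e₂, -, ⟨h₃, h'⟩ | ⟨h₃, h'⟩ | ⟨h₃, h₄, h'⟩⟩ <;> simp [h', ht]
  · norm_num [ht] at h₃
  · norm_num
  · norm_num

lemma word_pieceMap_infix : word (g.pieceMap p) <:+: g.edgeMap p.d := by
  rcases g.pieceMap_cases (p := p) with ⟨-, h₀, h'⟩ |
    ⟨-, e₁, e₂, h₀, ⟨h₃, h'⟩ | ⟨h₃, h'⟩ | ⟨h₃, h₄, h'⟩⟩ <;> rw [h₀, h']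
  · exact List.infix_rfl
  · exact ⟨[], [e₂], rfl⟩
  · exact ⟨[e₁], [], rfl⟩
  · exact List.infix_rfl

lemma word_pieceMap_prefix (hs : p.s = 0) :
    word (g.pieceMap p) <+: g.edgeMap p.d := by
  rcases g.pieceMap_cases (p := p) with ⟨-, h₀, h'⟩ |
    ⟨-, e₁, e₂, h₀, ⟨h₃, h'⟩ | ⟨h₃, h'⟩ | ⟨h₃, h₄, h'⟩⟩ <;> rw [h₀, h']
  · exact List.prefix_rfl
  · exact ⟨[e₂], rfl⟩
  · norm_num [hs] at h₃
  · exact List.prefix_rfl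

lemma word_pieceMap_suffix (ht : p.t = 1) :
    word (g.pieceMap p) <:+ g.edgeMap p.d := by
  rcases g.pieceMap_cases (p := p) with ⟨-, h₀, h'⟩ |
    ⟨-, e₁, e₂, h₀, ⟨h₃, h'⟩ | ⟨h₃, h'⟩ | ⟨h₃, h₄, h'⟩⟩ <;> rw [h₀, h']
  · exact List.suffix_rfl
  · norm_num [ht] at h₃
  · exact ⟨[e₁], rfl⟩
  · exact List.suffix_rfl

lemma word_pieceMap_full (hs : p.s = 0) (ht : p.t = 1) :
    word (g.pieceMap p) = g.edgeMap p.d := by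
  rcases g.pieceMap_cases (p := p) with ⟨-, h₀, h'⟩ |
    ⟨-, e₁, e₂, h₀, ⟨h₃, h'⟩ | ⟨h₃, h'⟩ | ⟨h₃, h₄, h'⟩⟩ <;> rw [h₀, h']
  · rfl
  · norm_num [ht] at h₃
  · norm_num [hs] at h₃
  · rfl

/-- Lengths are measured with every edge of the target of length one, so a fold doubles the pieces
on the folded petal and leaves the others unchanged. -/
lemma le_totalLength_pieceMap (h : p.Ok) : p.t - p.s ≤ totalLength (g.pieceMap p) := by
  have h₁ := h.2.1
  rcases g.pieceMap_cases (p := p) with ⟨-, h₀, h'⟩ |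
    ⟨-, e₁, e₂, h₀, ⟨h₃, h'⟩ | ⟨h₃, h'⟩ | ⟨h₃, h₄, h'⟩⟩ <;> rw [h'] <;> simp <;> linarith

lemma totalLength_pieceMap_of_fst_eq (hd : p.d.1 = g.u.1) :
    totalLength (g.pieceMap p) = 2 * (p.t - p.s) := by
  rcases g.pieceMap_cases (p := p) with ⟨h₀, -, h'⟩ |
    ⟨-, e₁, e₂, h₀, ⟨h₃, h'⟩ | ⟨h₃, h'⟩ | ⟨h₃, h₄, h'⟩⟩
  · exact absurd hd h₀
  all_goals
    rw [h']
    simp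
    ring

variable {ps : List (Piece r)}

lemma flatMap_pieceMap_head (h : ∀ p ∈ ps, p.Ok) (hs : ∀ p ∈ ps.head?, p.s = 0) :
    ∀ q ∈ (ps.flatMap g.pieceMap).head?, q.s = 0 := by
  rcases ps with - | ⟨p, ps⟩
  · simp
  · rw [List.flatMap_cons, List.head?_append_of_ne_nil _ (g.pieceMap_ne_nil)]
    exact g.pieceMap_head (by simpa using hs)

lemma isLinked_flatMap_pieceMap (h : IsLinked ps) : IsLinked (ps.flatMap g.pieceMap) := by
  refine ⟨fun q hq => ?_, ?_⟩
  · obtain ⟨p, hp, hq⟩ := List.mem_flatMap.1 hq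
    exact (g.isLinked_pieceMap (h.1 p hp)).1 q hq
  · rw [List.flatMap, List.isChain_flatten, List.isChain_map]
    · refine ⟨fun l hl => ?_, ?_⟩
      · obtain ⟨p, hp, rfl⟩ := List.mem_map.1 hl
        exact (g.isLinked_pieceMap (h.1 p hp)).2
      · induction ps with
        | nil => simp
        | cons p ps ih =>
          rcases ps with - | ⟨q, ps⟩
          · simp
          · rw [List.isChain_cons_cons]
            have hl := (List.isChain_cons_cons.1 h.2).1
            exact ⟨fun a ha b hb => ⟨g.pieceMap_last hl.1 a ha,
              g.pieceMap_head hl.2 b hb⟩, ih h.tail⟩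
    · simp only [List.mem_map, not_exists, not_and]
      exact fun p hp => g.pieceMap_ne_nil

lemma word_flatMap_pieceMap_prefix (h : IsLinked ps) (hs : ∀ p ∈ ps.head?, p.s = 0) :
    word (ps.flatMap g.pieceMap) <+: (word ps).flatMap g.edgeMap := by
  induction ps with
  | nil => exact List.prefix_rfl
  | cons p ps ih =>
    replace hs : p.s = 0 := by simpa using hs
    rcases ps with - | ⟨q, ps⟩
    · simpa using g.word_pieceMap_prefix hs
    · have hl := (List.isChain_cons_cons.1 h.2).1
      rw [List.flatMap_cons, word_append, word_cons, List.flatMap_cons,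
        g.word_pieceMap_full hs hl.1]
      exact (List.prefix_append_right_inj _).2 (ih h.tail (by simpa using hl.2))

lemma word_flatMap_pieceMap_infix (h : IsLinked ps) :
    word (ps.flatMap g.pieceMap) <:+: (word ps).flatMap g.edgeMap := by
  rcases ps with - | ⟨p, ps⟩
  · exact List.infix_rfl
  rcases ps with - | ⟨q, ps⟩
  · simpa using g.word_pieceMap_infix
  · have hl := (List.isChain_cons_cons.1 h.2).1
    obtain ⟨a, ha⟩ := g.word_pieceMap_suffix hl.1
    obtain ⟨b, hb⟩ := g.word_flatMap_pieceMap_prefix h.tail (by simpa using hl.2)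
    refine ⟨a, b, ?_⟩
    rw [List.flatMap_cons, word_append, word_cons, List.flatMap_cons (f := g.edgeMap), ← ha, ← hb]
    simp

end Fold

section piecesMap

variable {r : ℕ} (L : List (Fold r)) {ps : List (Piece r)}

lemma isLinked_piecesMap (h : IsLinked ps) : IsLinked (piecesMap L ps) := by
  induction L generalizing ps with
  | nil => exact h
  | cons g L ih => exact ih (g.isLinked_flatMap_pieceMap h)

lemma piecesMap_head (h : IsLinked ps) (hs : ∀ p ∈ ps.head?, p.s = 0) :
    ∀ q ∈ (piecesMap L ps).head?, q.s = 0 := by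
  induction L generalizing ps with
  | nil => exact hs
  | cons g L ih => exact ih (g.isLinked_flatMap_pieceMap h) (g.flatMap_pieceMap_head h.1 hs)

/-- Interior pieces cover whole edges; only the partial pieces at the two ends can lose letters of
the combinatorial image. When the path starts at the vertex nothing is lost at the start, which
gives the prefix version below. -/
lemma word_piecesMap_infix (h : IsLinked ps) : word (piecesMap L ps) <:+: wordMap L (word ps) := by
  induction L generalizing ps with
  | nil =>
    rw [wordMap_id]
    exact List.infix_rfl
  | cons g L ih =>
    rw [wordMap_fold_cons]
    exact (ih (g.isLinked_flatMap_pieceMap h)).trans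
      ((g.word_flatMap_pieceMap_infix h).wordMap L)

lemma word_piecesMap_prefix (h : IsLinked ps) (hs : ∀ p ∈ ps.head?, p.s = 0) :
    word (piecesMap L ps) <+: wordMap L (word ps) := by
  induction L generalizing ps with
  | nil =>
    rw [wordMap_id]
    exact List.prefix_rfl
  | cons g L ih =>
    rw [wordMap_fold_cons]
    refine (ih (g.isLinked_flatMap_pieceMap h) (g.flatMap_pieceMap_head h.1 hs)).trans ?_
    obtain ⟨t, ht⟩ := g.word_flatMap_pieceMap_prefix h hs
    exact ⟨wordMap L t, by rw [← ht, wordMap_append]⟩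

lemma piecesMap_append (ps qs : List (Piece r)) :
    piecesMap L (ps ++ qs) = piecesMap L ps ++ piecesMap L qs := by
  induction L generalizing ps qs with
  | nil => rfl
  | cons g L ih => simp [piecesMap, ih]

lemma piecesMap_nil : piecesMap L [] = [] := by
  induction L with
  | nil => rfl
  | cons g L ih => simpa [piecesMap] using ih

lemma totalLength_le_piecesMap (h : ∀ p ∈ ps, p.Ok) :
    totalLength ps ≤ totalLength (piecesMap L ps) := by
  induction L generalizing ps with
  | nil => rfl
  | cons g L ih =>
    refine le_trans ?_ (ih fun q hq => ?_)
    · clear ih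
      induction ps with
      | nil => simp
      | cons p ps ih =>
        rw [List.flatMap_cons, totalLength_append, totalLength_cons]
        exact add_le_add (g.le_totalLength_pieceMap (h p List.mem_cons_self))
          (ih fun q hq => h q (List.mem_cons_of_mem _ hq))
    · obtain ⟨p, hp, hq⟩ := List.mem_flatMap.1 hq
      exact (g.isLinked_pieceMap (h p hp)).1 q hq

variable {L}

/-- If the edge containing a piece gets folded, then the image is at least twice as long. -/
lemma two_mul_le_totalLength_singleton {p : Piece r} (h : p.Ok)
    (hL : ∃ g ∈ L, g.u.1 = p.d.1) : 2 * (p.t - p.s) ≤ totalLength (piecesMap L [p]) := by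
  induction L with
  | nil => simp at hL
  | cons g L ih =>
    -- The piece is untouched until its petal is first folded; there it doubles, and later folds do
    -- not shorten it.
    by_cases hg : p.d.1 = g.u.1
    · rw [← g.totalLength_pieceMap_of_fst_eq hg]
      simpa [piecesMap] using totalLength_le_piecesMap L (g.isLinked_pieceMap h).1
    · have : g.pieceMap p = [p] := by
        rcases g.pieceMap_cases (p := p) with h' | h'
        exacts [h'.2.2, absurd h'.1 hg]
      simp only [piecesMap, List.flatMap_cons, this, List.flatMap_nil, List.append_nil]
      refine ih ?_
      obtain ⟨g', hg', h'⟩ := hL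
      rcases List.mem_cons.1 hg' with rfl | hg'
      exacts [absurd h'.symm hg, ⟨g', hg', h'⟩]

lemma two_mul_le_totalLength (h : ∀ p ∈ ps, p.Ok) (hL : ∀ i, ∃ g ∈ L, g.u.1 = i) :
    2 * totalLength ps ≤ totalLength (piecesMap L ps) := by
  induction ps with
  | nil => simp [piecesMap_nil]
  | cons p ps ih =>
    rw [← List.singleton_append, piecesMap_append, totalLength_append, totalLength_append]
    have h₁ := ih fun q hq => h q (List.mem_cons_of_mem _ hq)
    have h₂ := two_mul_le_totalLength_singleton (h p List.mem_cons_self) (hL p.d.1)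
    simp only [totalLength_cons, totalLength_nil]
    linarith

end piecesMap

/-! ### Homotopy classes traced by pieces -/

/-- The homotopy class is that of the concatenation of the given pieces. -/
inductive Traces {r : ℕ} :
    List (Piece r) → ∀ {p q : Rose r}, Homotopic.Quotient p q → Prop
  | nil (p : Rose r) : Traces [] (Homotopic.Quotient.refl p)
  | cons {a : Piece r} {ps : List (Piece r)} {p q m : Rose r} {α : Homotopic.Quotient p q}
      {β : Homotopic.Quotient q m} (hα : IsSeg a.d a.s a.t α) (hβ : Traces ps β) :
      Traces (a :: ps) (α.trans β)

namespace Traces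

variable {r : ℕ} {ps qs : List (Piece r)} {p q m : Rose r} {γ : Homotopic.Quotient p q}

lemma single {a : Piece r} (h : IsSeg a.d a.s a.t γ) : Traces [a] γ := by
  have := Traces.cons h (Traces.nil q)
  rwa [Homotopic.Quotient.trans_refl] at this

lemma append {δ : Homotopic.Quotient q m} (h : Traces ps γ) (h' : Traces qs δ) :
    Traces (ps ++ qs) (γ.trans δ) := by
  induction h with
  | nil p => simpa using h'
  | cons hα hβ ih =>
    rw [Homotopic.Quotient.trans_assoc]
    exact .cons hα (ih h')

lemma inv (h : Traces ps γ) : Traces (invPieces ps) γ.symm := by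
  induction h with
  | nil p => exact Homotopic.Quotient.symm_refl (x := p) ▸ Traces.nil p
  | cons hα hβ ih =>
    rw [Homotopic.Quotient.symm_of_trans, invPieces_cons]
    exact ih.append (single hα.bar_symm)

lemma map_fold {g : Fold r} (h : Traces ps γ) (hp : ∀ p ∈ ps, p.Ok) :
    Traces (ps.flatMap g.pieceMap) (γ.map g.toMap) := by
  induction h with
  | nil p => exact Traces.nil _
  | @cons a ps p q m α β hα hβ ih =>
    rw [Homotopic.Quotient.map_trans, List.flatMap_cons]
    refine append ?_ (ih fun q hq => hp q (List.mem_cons_of_mem _ hq))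
    have ha := hp a List.mem_cons_self
    have ha' := ha.2.1
    rcases g.pieceMap_cases (p := a) with ⟨h₀, -, h'⟩ |
      ⟨-, e₁, e₂, h₀, ⟨h₃, h'⟩ | ⟨h₃, h'⟩ | ⟨h₃, h₄, h'⟩⟩ <;> rw [h']
    · exact single (hα.map_of_fst_ne h₀)
    · exact single (hα.map_first h₀ (by linarith) h₃)
    · exact single (hα.map_second h₀ h₃ (by linarith))
    -- The piece straddles the midpoint, so the class is cut there and each half is mapped
    -- separately.
    · obtain rfl := hα.source
      obtain rfl := hα.target
      obtain ⟨α₁, h₁⟩ := IsSeg.exists_isSeg a.d a.s (1 / 2)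
      obtain ⟨α₂, h₂⟩ := IsSeg.exists_isSeg a.d (1 / 2) a.t
      rw [hα.unique (h₁.trans h₂), Homotopic.Quotient.map_trans]
      have k₁ := h₁.map_first h₀ h₃.le le_rfl
      have k₂ := h₂.map_second h₀ le_rfl h₄.le
      norm_num at k₁ k₂
      exact .cons k₁ (single k₂)

lemma map {L : List (Fold r)} (h : Traces ps γ) (hp : IsLinked ps) :
    Traces (piecesMap L ps) (γ.map (composeMap L)) := by
  induction L generalizing ps p q γ with
  | nil =>
    induction γ using Path.Homotopic.Quotient.ind with | mk ρ =>
    exact h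
  | cons g L ih =>
    rw [composeMap, Homotopic.Quotient.map_comp]
    exact ih (h.map_fold hp.1) (g.isLinked_flatMap_pieceMap hp)

end Traces

/-! ### The universal covering space of the rose -/

namespace Rose

variable {r : ℕ}

/-- The map out of the rose with given values at the vertex and on the petals. -/
def desc {X : Type*} [TopologicalSpace X] (x : X) (φ : Fin r → C(I, X)) (h₀ : ∀ i, φ i 0 = x)
    (h₁ : ∀ i, φ i 1 = x) : C(Rose r, X) where
  toFun := Quot.lift (Sum.elim (fun _ => x) fun p => φ p.1 p.2) (by
    rintro _ _ (i | i)
    exacts [h₀ i, h₁ i])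
  continuous_toFun := by
    apply continuous_quot_lift
    exact continuous_sum_dom.2 ⟨continuous_const, continuous_sigma fun i => (φ i).continuous⟩

lemma desc_edge {X : Type*} [TopologicalSpace X] (x : X) (φ : Fin r → C(I, X)) (h₀ h₁)
    (i : Fin r) (t : I) : desc x φ h₀ h₁ (edge (i, true) t) = φ i t := by
  rw [edge_coe]
  rfl

/-- A function that is positive exactly in the interior of the `i`-th petal, with maximum `1 / 4`
at the midpoint. -/
noncomputable def height (i : Fin r) : C(Rose r, ℝ) :=
  desc 0 (fun j => if j = i then ⟨fun t => (t : ℝ) * (1 - t), by fun_prop⟩ else 0)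
    (fun j => by split_ifs <;> simp) (fun j => by split_ifs <;> simp)

/-- A function that is positive on the first half of the `i`-th petal and negative on the
second. -/
noncomputable def side (i : Fin r) : C(Rose r, ℝ) :=
  desc 0 (fun j => if j = i then ⟨fun t => (t : ℝ) * (1 - t) * (1 / 2 - t), by fun_prop⟩ else 0)
    (fun j => by split_ifs <;> simp) (fun j => by split_ifs <;> simp)

lemma height_vertex (i : Fin r) : height i (vertex r) = 0 := rfl

lemma height_edge (i j : Fin r) (t : I) :
    height i (edge (j, true) t) = if j = i then (t : ℝ) * (1 - t) else 0 := by
  rw [height, desc_edge]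
  split_ifs <;> rfl

lemma side_edge (i j : Fin r) (t : I) :
    side i (edge (j, true) t) = if j = i then (t : ℝ) * (1 - t) * (1 / 2 - t) else 0 := by
  rw [side, desc_edge]
  split_ifs <;> rfl

open Classical in
/-- The generator attached to the interior of the second half of each petal. -/
noncomputable def mark : Rose r → FreeGroup (Fin r) :=
  Quot.lift (Sum.elim (fun _ => 1)
    fun p => if 1 / 2 < (p.2 : ℝ) ∧ (p.2 : ℝ) < 1 then FreeGroup.of p.1 else 1) (by
      rintro _ _ (i | i) <;> simp)

lemma mark_vertex : mark (vertex r) = 1 := rfl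

lemma mark_edge (i : Fin r) (t : ℝ) :
    mark (edge (i, true) t) = if 1 / 2 < t ∧ t < 1 then FreeGroup.of i else 1 := by
  rcases le_total t 0 with h | h
  · rw [edge_of_le h, mark_vertex, if_neg (fun h' => by linarith [h'.1])]
  rcases le_total 1 t with h' | h'
  · rw [edge_of_ge h', mark_vertex, if_neg (fun h'' => by linarith [h''.2])]
  · rw [edge_coe (i, true) ⟨t, h, h'⟩]
    change (if _ then _ else _) = _
    congr

/-- The open sets over which the universal covering is trivialized: the complement of the midpoints
and the interiors of the petals. -/
def chartSet : Option (Fin r) → Set (Rose r)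
  | none => {p | ∀ i, height i p ≠ 1 / 4}
  | some i => {p | 0 < height i p}

lemma isOpen_chartSet (a : Option (Fin r)) : IsOpen (chartSet a) := by
  cases a with
  | none =>
    simp only [chartSet, Set.ofPred_forall]
    exact isOpen_iInter_of_finite fun i =>
      isOpen_ne_fun (height i).continuous continuous_const
  | some i => exact isOpen_lt continuous_const (height i).continuous

/-- The coordinate, in a chart, of the sheet with label `1`. -/
noncomputable def chartMark : Option (Fin r) → Rose r → FreeGroup (Fin r)
  | none => mark
  | some _ => 1

/-- On the overlap of the two charts `side` does not vanish, so this makes the discontinuous `mark`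
locally constant there. -/
lemma mark_eq_of_mem {i : Fin r} {p : Rose r} (hp : p ∈ chartSet none ∩ chartSet (some i)) :
    mark p = if side i p < 0 then FreeGroup.of i else 1 := by
  obtain ⟨h₁, h₂ : 0 < height i p⟩ := hp
  rcases exists_eq_edge p with rfl | ⟨j, t, rfl⟩
  · rw [height_vertex] at h₂
    exact absurd h₂ (lt_irrefl _)
  · have h₃ := h₁ i
    rw [height_edge] at h₂ h₃
    rw [mark_edge, side_edge]
    split_ifs at h₂ h₃ with hj
    · subst hj
      rw [if_pos rfl]
      have h0 := t.2.1
      have h1 := t.2.2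
      have hlt : (t : ℝ) < 1 := by
        rcases h1.lt_or_eq with h | h
        · exact h
        · rw [h] at h₂
          norm_num at h₂
      refine if_congr ?_ rfl rfl
      constructor
      · rintro ⟨h, -⟩
        nlinarith
      · intro h
        refine ⟨?_, hlt⟩
        by_contra h'
        nlinarith
    · exact absurd h₂ (lt_irrefl _)

open Classical in
/-- A chart around a given point. -/
noncomputable def chartAt (p : Rose r) : Option (Fin r) :=
  if h : ∃ i, 0 < height i p then some h.choose else none

lemma mem_chartSet_chartAt (p : Rose r) : p ∈ chartSet (chartAt p) := by
  unfold chartAt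
  split_ifs with h
  · exact h.choose_spec
  · intro i hi
    exact h ⟨i, by rw [hi]; norm_num⟩

/-- This normalizes labels: a point labelled `g` in its preferred chart has coordinate `g *
chartMark a p` in every chart `a` containing `p`. -/
lemma chartMark_chartAt (p : Rose r) : chartMark (chartAt p) p = 1 := by
  unfold chartAt
  split_ifs with h
  · rfl
  · change mark p = 1
    rcases exists_eq_edge p with rfl | ⟨i, t, rfl⟩
    · rfl
    · rw [mark_edge, if_neg]
      rintro ⟨h₁, h₂⟩
      refine h ⟨i, ?_⟩
      rw [height_edge, if_pos rfl]
      nlinarith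

end Rose

/-- The free group on the petals, as a discrete space. -/
instance instTopologicalSpaceFreeGroupFin (r : ℕ) : TopologicalSpace (FreeGroup (Fin r)) := ⊥

instance instDiscreteTopologyFreeGroupFin (r : ℕ) : DiscreteTopology (FreeGroup (Fin r)) := ⟨rfl⟩

namespace Rose

variable {r : ℕ}

/-- The transition functions of the universal covering of the rose. -/
noncomputable def coverCore (r : ℕ) : FiberBundleCore (Option (Fin r)) (Rose r) (FreeGroup (Fin r)) where
  baseSet := chartSet
  isOpen_baseSet := isOpen_chartSet
  indexAt := chartAt
  mem_baseSet_at := mem_chartSet_chartAt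
  -- The cocycle is a coboundary of `chartMark`, so the cocycle identities are formal and only
  -- continuity on overlaps needs work.
  coordChange a b p g := g * (chartMark a p)⁻¹ * chartMark b p
  coordChange_self a p _ g := by simp
  coordChange_comp a b c p _ g := by simp
  continuousOn_coordChange a b := by
    have key : ∀ i, ContinuousOn (fun p : Rose r × FreeGroup (Fin r) => mark p.1)
        ((chartSet none ∩ chartSet (some i)) ×ˢ Set.univ) := by
      intro i
      have h : ContinuousOn (fun p : Rose r × FreeGroup (Fin r) =>
          if side i p.1 < 0 then FreeGroup.of i else 1)
          ((chartSet none ∩ chartSet (some i)) ×ˢ Set.univ) := by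
        rintro ⟨p, g⟩ ⟨⟨h₁, h₂⟩, -⟩
        refine ContinuousAt.continuousWithinAt ?_
        have hne : side i p ≠ 0 := by
          have h₂' : 0 < height i p := h₂
          have h₃ : height i p ≠ 1 / 4 := h₁ i
          rcases exists_eq_edge p with rfl | ⟨j, t, rfl⟩
          · rw [height_vertex] at h₂'
            exact absurd h₂' (lt_irrefl _)
          · rw [height_edge] at h₂' h₃
            rw [side_edge]
            split_ifs at h₂' h₃ ⊢ with hj
            · refine mul_ne_zero h₂'.ne' fun h => h₃ ?_
              rw [show (t : ℝ) = 1 / 2 by linarith]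
              norm_num
            · exact absurd h₂' (lt_irrefl _)
        have hc : Continuous fun p : Rose r × FreeGroup (Fin r) => side i p.1 :=
          (side i).continuous.comp continuous_fst
        rcases lt_or_gt_of_ne hne with h | h
        · refine ContinuousAt.congr (f := fun _ => FreeGroup.of i)
            continuousAt_const ?_
          filter_upwards [(isOpen_lt hc continuous_const).mem_nhds h] with q hq
          rw [if_pos hq]
        · refine ContinuousAt.congr (f := fun _ => (1 : FreeGroup (Fin r))) continuousAt_const ?_
          filter_upwards [(isOpen_lt continuous_const hc).mem_nhds h] with q hq
          rw [if_neg (not_lt.2 (le_of_lt hq))]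
      refine h.congr ?_
      rintro ⟨p, g⟩ ⟨hp, -⟩
      exact mark_eq_of_mem hp
    have hm : Continuous fun q : FreeGroup (Fin r) × FreeGroup (Fin r) => q.1 * q.2 := continuous_of_discreteTopology
    have hi : Continuous fun q : FreeGroup (Fin r) => q⁻¹ := continuous_of_discreteTopology
    cases a with
    | none =>
      cases b with
      | none => simpa using continuous_snd.continuousOn
      | some i =>
        have h := hm.comp_continuousOn (continuous_snd.continuousOn.prodMk
          (hi.comp_continuousOn (key i)))
        refine h.congr ?_
        rintro ⟨p, g⟩ -
        exact mul_one _
    | some i =>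
      cases b with
      | none =>
        have h := hm.comp_continuousOn (continuous_snd.continuousOn.prodMk (key i))
        rw [Set.inter_comm]
        refine h.congr ?_
        rintro ⟨p, g⟩ -
        change g * 1⁻¹ * _ = g * _
        rw [inv_one, mul_one]
        rfl
      | some j =>
        refine continuous_snd.continuousOn.congr ?_
        rintro ⟨p, g⟩ -
        change g * 1⁻¹ * 1 = g
        rw [inv_one, mul_one, mul_one]

/-- The universal covering space of the rose. -/
abbrev Cover (r : ℕ) : Type := (coverCore r).TotalSpace

lemma isCoveringMap_proj (r : ℕ) : IsCoveringMap (coverCore r).proj :=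
  FiberBundle.isCoveringMap

/-- The point of the universal covering space over `p` on the sheet labelled `g`. -/
def sheetPoint (p : Rose r) (g : FreeGroup (Fin r)) : Cover r := ⟨p, g⟩

/-- The lift of the `i`-th petal that starts on the sheet labelled `g`. -/
noncomputable def liftEdge (i : Fin r) (g : FreeGroup (Fin r)) (t : ℝ) : Cover r :=
  sheetPoint (edge (i, true) t) (if t < 1 then g else g * FreeGroup.of i)

lemma continuous_liftEdge (i : Fin r) (g : FreeGroup (Fin r)) : Continuous (liftEdge i g) := by
  rw [continuous_iff_continuousAt]
  intro t₀
  -- It suffices to find a chart in which the sheet coordinate is constant near `t₀`.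
  have key : ∀ (a : Option (Fin r)) (x : FreeGroup (Fin r)),
      (∀ᶠ t in nhds t₀, edge (i, true) t ∈ chartSet a ∧
        (if t < 1 then g else g * FreeGroup.of i) * chartMark a (edge (i, true) t) = x) →
      ContinuousAt (liftEdge i g) t₀ := by
    intro a x h
    refine (((coverCore r).localTriv a).toOpenPartialHomeomorph.continuousAt_iff_continuousAt_comp_left
      ?_).2 ?_
    · filter_upwards [h] with t ht using ht.1
    · refine ContinuousAt.congr (f := fun t => (edge (i, true) t, x))
        ((edge (i, true)).continuous.continuousAt.prodMk continuousAt_const) ?_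
      filter_upwards [h] with t ht
      refine Prod.ext rfl ?_
      change x = (if t < 1 then g else g * FreeGroup.of i) *
        (chartMark (chartAt (edge (i, true) t)) (edge (i, true) t))⁻¹ *
          chartMark a (edge (i, true) t)
      rw [chartMark_chartAt, inv_one, mul_one]
      exact ht.2.symm
  have hlow : ∀ t : ℝ, t < 1 / 2 → edge (i, true) t ∈ chartSet (r := r) none := by
    intro t ht j
    rcases le_total t 0 with h | h
    · rw [edge_of_le h, height_vertex]
      norm_num
    · have := height_edge j i ⟨t, h, by linarith⟩
      dsimp only at this
      rw [this]
      split_ifs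
      · nlinarith
      · norm_num
  have hmid : ∀ t : ℝ, 0 < t → t < 1 → edge (i, true) t ∈ chartSet (r := r) (some i) := by
    intro t h h'
    have := height_edge i i ⟨t, h.le, h'.le⟩
    dsimp only at this
    change 0 < height i _
    rw [this, if_pos rfl]
    nlinarith
  have hhigh : ∀ t : ℝ, 1 / 2 < t → edge (i, true) t ∈ chartSet (r := r) none := by
    intro t ht j
    rcases le_total 1 t with h | h
    · rw [edge_of_ge h, height_vertex]
      norm_num
    · have := height_edge j i ⟨t, by linarith, h⟩
      dsimp only at this
      rw [this]
      split_ifs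
      · nlinarith
      · norm_num
  -- In the vertex chart the coordinate is `g` before the midpoint and `g * FreeGroup.of i` after
  -- it: there `mark` supplies the generator up to `t = 1`, and the label itself from `t = 1` on.
  -- The petal chart bridges the midpoint.
  rcases lt_or_ge t₀ (1 / 2) with h | h
  · refine key none g ?_
    filter_upwards [Iio_mem_nhds h] with t (ht : t < 1 / 2)
    refine ⟨hlow t ht, ?_⟩
    rw [chartMark, mark_edge, if_pos (by linarith), if_neg (fun h => by linarith [h.1]), mul_one]
  rcases lt_or_ge t₀ 1 with h' | h'
  · refine key (some i) g ?_
    filter_upwards [Ioo_mem_nhds (show (0 : ℝ) < t₀ by linarith) h'] with t ht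
    refine ⟨hmid t ht.1 ht.2, ?_⟩
    change _ * 1 = g
    rw [if_pos ht.2, mul_one]
  · refine key none (g * FreeGroup.of i) ?_
    filter_upwards [Ioi_mem_nhds (show 1 / 2 < t₀ by linarith)] with t (ht : 1 / 2 < t)
    refine ⟨hhigh t ht, ?_⟩
    rw [chartMark, mark_edge]
    by_cases h1 : t < 1
    · rw [if_pos h1, if_pos ⟨ht, h1⟩]
    · rw [if_neg h1, if_neg (fun h => h1 h.2), mul_one]

end Rose

/-- The homotopy class lifts to a homotopy class in the universal covering space from the sheet
labelled `g` to the sheet labelled `g'`. -/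
def LiftsTo {r : ℕ} {p q : Rose r} (γ : Homotopic.Quotient p q) (g g' : FreeGroup (Fin r)) : Prop :=
  ∃ Γ : Homotopic.Quotient (Rose.sheetPoint p g) (Rose.sheetPoint q g'),
    Γ.map ⟨(Rose.coverCore r).proj, (Rose.isCoveringMap_proj r).continuous⟩ = γ

namespace LiftsTo

variable {r : ℕ} {p q m : Rose r} {γ : Homotopic.Quotient p q} {g g' g'' : FreeGroup (Fin r)}

/-- Monodromy of the covering: the endpoint of a lift is determined by its starting point and the
homotopy class. -/
lemma unique (h : LiftsTo γ g g') (h' : LiftsTo γ g g'') : g' = g'' := by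
  obtain ⟨Γ, hΓ⟩ := h
  obtain ⟨Γ', hΓ'⟩ := h'
  have h₁ := (Rose.isCoveringMap_proj r).monodromy_map Γ
  have h₂ := (Rose.isCoveringMap_proj r).monodromy_map Γ'
  have h₃ : (Rose.isCoveringMap_proj r).monodromy γ ⟨Rose.sheetPoint p g, rfl⟩ =
      ⟨Rose.sheetPoint q g', rfl⟩ := by rw [← hΓ]; exact h₁
  have h₄ : (Rose.isCoveringMap_proj r).monodromy γ ⟨Rose.sheetPoint p g, rfl⟩ =
      ⟨Rose.sheetPoint q g'', rfl⟩ := by rw [← hΓ']; exact h₂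
  have h₅ : Rose.sheetPoint q g' = Rose.sheetPoint q g'' :=
    congrArg Subtype.val (h₃.symm.trans h₄)
  exact eq_of_heq (Bundle.TotalSpace.mk.inj h₅).2

lemma refl (p : Rose r) (g : FreeGroup (Fin r)) : LiftsTo (Homotopic.Quotient.refl p) g g :=
  ⟨Homotopic.Quotient.refl _, rfl⟩

lemma trans {δ : Homotopic.Quotient q m} (h : LiftsTo γ g g') (h' : LiftsTo δ g' g'') :
    LiftsTo (γ.trans δ) g g'' := by
  obtain ⟨Γ, rfl⟩ := h
  obtain ⟨Δ, rfl⟩ := h'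
  exact ⟨Γ.trans Δ, Homotopic.Quotient.map_trans _ _ _⟩

end LiftsTo

lemma IsSeg.liftsTo {r : ℕ} {p q : Rose r} {α : Homotopic.Quotient p q} {i : Fin r} {s t : ℝ}
    (h : IsSeg (i, true) s t α) (g : FreeGroup (Fin r)) :
    LiftsTo α (if s < 1 then g else g * FreeGroup.of i) (if t < 1 then g else g * FreeGroup.of i) := by
  obtain rfl := h.source
  obtain rfl := h.target
  obtain ⟨c, ρ, rfl, h⟩ := h
  refine ⟨Homotopic.Quotient.mk (c.map (Rose.continuous_liftEdge i g)), ?_⟩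
  exact congrArg Homotopic.Quotient.mk (Path.ext (funext fun τ => (h τ).symm))

/-! ### Sheet labels read off from edge words, and the resulting length bound. -/

section bound

variable {r : ℕ} {p q : Rose r} {ps : List (Piece r)}

/-- The label changes only at the terminal end of a positively oriented petal, so a full edge always
contributes its letter, while a partial piece contributes it exactly when it touches that end. -/
lemma IsSeg.liftsTo_of_ok {α : Homotopic.Quotient p q} {a : Piece r} (h : IsSeg a.d a.s a.t α)
    (ha : a.Ok) (g : FreeGroup (Fin r)) :
    ((a.s ≠ 0 ∨ a.t ≠ 1) ∧ LiftsTo α g g) ∨ LiftsTo α g (g * FreeGroup.mk [a.d]) := by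
  obtain ⟨⟨i, b⟩, s, t⟩ := a
  obtain ⟨h₀, h₁, h₂⟩ := ha
  dsimp only at h h₀ h₁ h₂ ⊢
  cases b
  · have h' := h.bar
    have key := h'.liftsTo (g * (FreeGroup.of i)⁻¹)
    have key' := h'.liftsTo g
    rw [if_pos (show 1 - t < 1 by linarith)] at key key'
    by_cases hs : s = 0
    · rw [if_neg (show ¬1 - s < 1 by linarith), inv_mul_cancel_right] at key
      exact Or.inr key
    · have : 1 - s < 1 := by
        have := lt_of_le_of_ne h₀ (Ne.symm hs)
        linarith
      rw [if_pos this] at key'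
      exact Or.inl ⟨Or.inl hs, key'⟩
  · have key := h.liftsTo g
    rw [if_pos (by linarith)] at key
    by_cases ht : t = 1
    · rw [if_neg (by linarith)] at key
      exact Or.inr key
    · rw [if_pos (lt_of_le_of_ne h₂ ht)] at key
      exact Or.inl ⟨Or.inr ht, key⟩

/-- Starting at the vertex, every piece but the last is a full edge, so at most the last letter is
missing from the label. -/
lemma Traces.exists_liftsTo_of_head {γ : Homotopic.Quotient p q} (h : Traces ps γ)
    (hp : IsLinked ps) (hs : ∀ p ∈ ps.head?, p.s = 0) (g : FreeGroup (Fin r)) :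
    ∃ v, v <+: word ps ∧ ps.length ≤ v.length + 1 ∧ LiftsTo γ g (g * FreeGroup.mk v) := by
  induction h generalizing g with
  | nil p =>
    refine ⟨[], List.prefix_rfl, by simp, ?_⟩
    rw [← FreeGroup.one_eq_mk, mul_one]
    exact LiftsTo.refl p g
  | @cons a ps p q m α β hα hβ ih =>
    rcases ps with - | ⟨b, ps⟩
    · cases hβ
      rcases hα.liftsTo_of_ok hp.head g with ⟨-, h⟩ | h
      · refine ⟨[], ⟨[a.d], rfl⟩, by simp, ?_⟩
        rw [← FreeGroup.one_eq_mk, mul_one]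
        exact h.trans (LiftsTo.refl _ _)
      · exact ⟨[a.d], List.prefix_rfl, by simp, h.trans (LiftsTo.refl _ _)⟩
    · have hl := (List.isChain_cons_cons.1 hp.2).1
      rcases hα.liftsTo_of_ok hp.head g with ⟨h, -⟩ | h
      · exact absurd h (by simp [hl.1, hs a (by simp)])
      · obtain ⟨v, hv, hlen, hL⟩ := ih hp.tail (by simpa using hl.2) (g * FreeGroup.mk [a.d])
        refine ⟨a.d :: v, List.cons_prefix_cons.2 ⟨rfl, hv⟩, by simpa using hlen, ?_⟩
        rw [mul_assoc, FreeGroup.mul_mk, List.singleton_append] at hL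
        exact h.trans hL

/-- Only the first and last pieces can be partial, which accounts for the `+ 2`. -/
lemma Traces.exists_liftsTo {γ : Homotopic.Quotient p q} (h : Traces ps γ)
    (hp : IsLinked ps) (g : FreeGroup (Fin r)) :
    ∃ v, v <:+: word ps ∧ ps.length ≤ v.length + 2 ∧ LiftsTo γ g (g * FreeGroup.mk v) := by
  cases h with
  | nil p =>
    refine ⟨[], List.infix_rfl, by simp, ?_⟩
    rw [← FreeGroup.one_eq_mk, mul_one]
    exact LiftsTo.refl p g
  | @cons a ps _ q _ α β hα hβ =>
    have hl : ∀ b ∈ ps.head?, b.s = 0 := fun b hb => (hp.link b hb).2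
    rcases hα.liftsTo_of_ok hp.head g with ⟨-, h⟩ | h
    · obtain ⟨v, hv, hlen, hL⟩ := hβ.exists_liftsTo_of_head hp.tail hl g
      exact ⟨v, hv.isInfix.trans (List.suffix_cons _ _).isInfix, by simpa using hlen, h.trans hL⟩
    · obtain ⟨v, hv, hlen, hL⟩ := hβ.exists_liftsTo_of_head hp.tail hl (g * FreeGroup.mk [a.d])
      refine ⟨a.d :: v, (List.cons_prefix_cons.2 ⟨rfl, hv⟩).isInfix, ?_, ?_⟩
      · simp only [List.length_cons] at *
        omega
      · rw [mul_assoc, FreeGroup.mul_mk, List.singleton_append] at hL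
        exact h.trans hL

/-- The reduced edge paths in a given homotopy class have bounded length. -/
lemma exists_length_le (γ : Homotopic.Quotient p q) :
    ∃ N : ℕ, ∀ ps : List (Piece r), Traces ps γ → IsLinked ps →
      (word ps).IsChain (fun e e' => e' ≠ e.bar) → ps.length ≤ N := by
  -- If the class has no such lift, it is not traced by linked pieces at all, and any bound will do.
  by_cases h : ∃ g', LiftsTo γ 1 g'
  · obtain ⟨g', h⟩ := h
    refine ⟨g'.norm + 2, fun ps hps hlink hred => ?_⟩
    obtain ⟨v, hv, hlen, hL⟩ := hps.exists_liftsTo hlink 1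
    rw [one_mul] at hL
    rw [h.unique hL]
    have hv' : FreeGroup.IsReduced v := by
      refine (List.IsChain.infix hred hv).imp fun a b hab h₁ => ?_
      by_contra h₂
      refine hab (Prod.ext h₁.symm ?_)
      simp only [Dir.bar]
      rcases a with ⟨_, _ | _⟩ <;> rcases b with ⟨_, _ | _⟩ <;> simp_all
    rw [FreeGroup.norm, FreeGroup.toWord_mk, hv'.reduce_eq]
    exact hlen
  · refine ⟨0, fun ps hps hlink _ => ?_⟩
    obtain ⟨v, -, -, hL⟩ := hps.exists_liftsTo hlink 1
    exact absurd ⟨_, hL⟩ h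

end bound

/-! ### Paths in the rose are products of straight segments -/

/-- A property of homotopy classes of paths that is compatible with products and holds for paths
inside the members of an open cover holds for all classes. -/
lemma Path.Homotopic.Quotient.induction_of_cover {X ι : Type*} [TopologicalSpace X]
    {S : ∀ {p q : X}, Homotopic.Quotient p q → Prop}
    (hrefl : ∀ p : X, S (Homotopic.Quotient.refl p))
    (htrans : ∀ {p q m : X} {α : Homotopic.Quotient p q} {β : Homotopic.Quotient q m},
      S α → S β → S (α.trans β))
    {U : ι → Set X} (hU : ∀ i, IsOpen (U i)) (hcover : ∀ x, ∃ i, x ∈ U i)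
    (h : ∀ i (p q : X) (ρ : Path p q), (∀ τ, ρ τ ∈ U i) → S (Homotopic.Quotient.mk ρ))
    {p q : X} (α : Homotopic.Quotient p q) : S α := by
  induction α using Quotient.ind with | mk ρ =>
  obtain ⟨t, ht₀, hmono, ⟨n, hn⟩, ht⟩ := exists_monotone_Icc_subset_open_cover_unitInterval
    (c := fun i => ρ ⁻¹' U i) (fun i => (hU i).preimage ρ.continuous)
    (fun x _ => Set.mem_iUnion.2 (hcover (ρ x)))
  have key : ∀ k, S (Homotopic.Quotient.mk (ρ.subpath 0 (t k))) := by
    intro k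
    induction k with
    | zero =>
      rw [ht₀, Path.subpath_self]
      exact hrefl _
    | succ k ih =>
      obtain ⟨i, hi⟩ := ht k
      have hs : S (Homotopic.Quotient.mk (ρ.subpath (t k) (t (k + 1)))) := by
        refine h i _ _ _ fun τ => ?_
        have : ρ.subpath (t k) (t (k + 1)) τ ∈ ρ '' Set.Icc (t k) (t (k + 1)) := by
          rw [← Path.range_subpath_of_le ρ _ _ (hmono k.le_succ)]
          exact Set.mem_range_self τ
        obtain ⟨x, hx, hx'⟩ := this
        rw [← hx']
        exact hi hx
      have := htrans ih hs
      rwa [← Homotopic.Quotient.mk_trans,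
        Homotopic.Quotient.eq.2 ⟨Path.Homotopy.subpathTransSubpath ρ 0 (t k) (t (k + 1))⟩] at this
  have h1 := key n
  rw [hn n le_rfl, Path.subpath_zero_one] at h1
  obtain ⟨f, rfl, rfl⟩ := ρ
  exact h1

namespace Rose

variable {r : ℕ}

/-- The deformation of the rose, parametrized by the points of the rose, that pushes the outer
thirds of each petal into the vertex. -/
noncomputable def squash : C(Rose r, C(I, Rose r)) :=
  desc (.const _ (vertex r))
    (fun i => ContinuousMap.curry ⟨fun x : I × I => edge (i, true)
      ((1 - x.2) * x.1 + x.2 * max 0 (min 1 (3 * (x.1 : ℝ) - 1))),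
        (edge (i, true)).continuous.comp (by fun_prop)⟩)
    (fun i => by ext s; simp)
    (fun i => by ext s; norm_num)

lemma squash_edge (i : Fin r) (t s : I) : squash (edge (i, true) t) s =
    edge (i, true) ((1 - s) * t + s * max 0 (min 1 (3 * (t : ℝ) - 1))) := by
  rw [squash, desc_edge]
  rfl

/-- The end of the deformation `squash`. -/
noncomputable def squashMap : C(Rose r, Rose r) := ⟨fun p => squash p 1, by fun_prop⟩

/-- The deformation `squash` as a homotopy. -/
noncomputable def squashHomotopy : (ContinuousMap.id (Rose r)).Homotopy squashMap where
  toFun x := squash x.2 x.1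
  continuous_toFun := by fun_prop
  map_zero_left p := by
    rcases exists_eq_edge p with rfl | ⟨i, t, rfl⟩
    · rfl
    · simp [squash_edge]
  map_one_left p := rfl

lemma squashMap_of_height_lt {p : Rose r} (h : ∀ i, height i p < 2 / 9) :
    squashMap p = vertex r := by
  rcases exists_eq_edge p with rfl | ⟨i, t, rfl⟩
  · rfl
  have h := h i
  rw [height_edge, if_pos rfl] at h
  rw [squashMap, ContinuousMap.coe_mk, squash_edge]
  have : (t : ℝ) < 1 / 3 ∨ 2 / 3 < (t : ℝ) := by
    by_contra! h'
    nlinarith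
  rcases this with h' | h'
  · rw [max_eq_left ((min_le_right _ _).trans (by linarith))]
    simp
  · rw [min_eq_left (by linarith)]
    simp

/-- The coordinate on the first three quarters of the `i`-th petal. -/
noncomputable def coord (i : Fin r) : C(Rose r, ℝ) :=
  desc 0 (fun j => if j = i then ⟨fun t => min (t : ℝ) (3 * (1 - t)), by fun_prop⟩ else 0)
    (fun j => by split_ifs <;> simp) (fun j => by split_ifs <;> simp)

lemma eq_edge_coord {i : Fin r} {p : Rose r} (h : 3 / 16 < height i p) :
    p = edge (i, true) (coord i p) ∧ 0 ≤ coord i p ∧ coord i p ≤ 1 := by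
  rcases exists_eq_edge p with rfl | ⟨j, t, rfl⟩
  · rw [height_vertex] at h
    norm_num at h
  · rw [height_edge] at h
    split_ifs at h with hj
    · subst hj
      have : coord j (edge (j, true) t) = t := by
        rw [coord, desc_edge, if_pos rfl]
        refine min_eq_left ?_
        have := t.2.1
        have := t.2.2
        nlinarith
      rw [this]
      exact ⟨rfl, t.2.1, t.2.2⟩
    · norm_num at h

/-- A property of homotopy classes of paths in the rose that is compatible with products and holds
for straight segments holds for all classes. -/
lemma induction_of_isSeg {S : ∀ {p q : Rose r}, Homotopic.Quotient p q → Prop}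
    (hrefl : ∀ p : Rose r, S (Homotopic.Quotient.refl p))
    (hseg : ∀ {p q : Rose r} {α : Homotopic.Quotient p q} {d : Dir r} {s t : ℝ},
      0 ≤ s → s ≤ 1 → 0 ≤ t → t ≤ 1 → IsSeg d s t α → S α)
    (htrans : ∀ {p q m : Rose r} {α : Homotopic.Quotient p q} {β : Homotopic.Quotient q m},
      S α → S β → S (α.trans β))
    {p q : Rose r} (α : Homotopic.Quotient p q) : S α := by
  have hconst : ∀ {v a b : Rose r} (ρ : Path a b), (∀ τ, ρ τ = v) →
      S (Homotopic.Quotient.mk ρ) := by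
    intro v a b ρ h
    obtain rfl : a = v := by simpa using h 0
    obtain rfl : b = a := by simpa using h 1
    rw [show ρ = Path.refl _ from Path.ext (funext h)]
    exact hrefl _
  have htrack : ∀ p : Rose r, S (Homotopic.Quotient.mk (squashHomotopy.evalAt p)) ∧
      S (Homotopic.Quotient.mk (squashHomotopy.evalAt p)).symm := by
    intro p
    rcases exists_eq_edge p with rfl | ⟨i, t, rfl⟩
    · rw [← Homotopic.Quotient.mk_symm]
      exact ⟨hconst (v := vertex r) _ fun τ => rfl, hconst (v := vertex r) _ fun τ => rfl⟩
    · have hs : IsSeg (i, true) t (max 0 (min 1 (3 * (t : ℝ) - 1)))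
          (Homotopic.Quotient.mk (squashHomotopy.evalAt (edge (i, true) t))) :=
        IsSeg.of_curve ⟨⟨fun s : I => (1 - s) * t + s * max 0 (min 1 (3 * (t : ℝ) - 1)), by fun_prop⟩,
          by simp, by simp⟩ _ fun s => squash_edge i t s
      have h0 : 0 ≤ max (0 : ℝ) (min 1 (3 * (t : ℝ) - 1)) := le_max_left _ _
      have h1 : max (0 : ℝ) (min 1 (3 * (t : ℝ) - 1)) ≤ 1 := max_le zero_le_one (min_le_left _ _)
      exact ⟨hseg t.2.1 t.2.2 h0 h1 hs, hseg h0 h1 t.2.1 t.2.2 hs.symm⟩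
  -- The thresholds are the heights at the parameters `1/3` and `1/4`: `2/9 = 1/3 * 2/3` and `3/16 =
  -- 1/4 * 3/4`. As `3/16 < 2/9`, these sets cover. The first is squashed to the vertex, and on the
  -- others `coord` is a continuous parameter.
  refine Homotopic.Quotient.induction_of_cover (ι := Option (Fin r)) (S := S) hrefl htrans
    (U := fun a => a.elim {p | ∀ i, height i p < 2 / 9} fun i => {p | 3 / 16 < height i p})
    ?_ ?_ ?_ α
  · rintro (_ | i)
    · simp only [Option.elim, Set.ofPred_forall]
      exact isOpen_iInter_of_finite fun i => isOpen_lt (height i).continuous continuous_const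
    · exact isOpen_lt continuous_const (height i).continuous
  · intro p
    by_cases h : ∃ i, 3 / 16 < height i p
    · obtain ⟨i, hi⟩ := h
      exact ⟨some i, hi⟩
    · push Not at h
      exact ⟨none, fun i => (h i).trans_lt (by norm_num)⟩
  · rintro (_ | i) p q ρ hρ
    · have h1 := Homotopic.Quotient.eq.2 (Path.Homotopic.map_trans_evalAt squashHomotopy ρ)
      rw [Homotopic.Quotient.mk_trans, Homotopic.Quotient.mk_trans] at h1
      -- Near the vertex the path is homotopic to the track of `p`, followed by a constant path,
      -- followed by the reversed track of `q`; both tracks are straight segments.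
      have h2 : Homotopic.Quotient.mk ρ = ((Homotopic.Quotient.mk (squashHomotopy.evalAt p)).trans
          (Homotopic.Quotient.mk (ρ.map (map_continuous squashMap)))).trans
            (Homotopic.Quotient.mk (squashHomotopy.evalAt q)).symm := by
        rw [← h1, Homotopic.Quotient.trans_assoc, Homotopic.Quotient.trans_symm,
          Homotopic.Quotient.trans_refl]
        rfl
      rw [h2]
      exact htrans (htrans (htrack p).1 (hconst (v := vertex r) _ fun τ =>
        squashMap_of_height_lt (hρ τ))) (htrack q).2
    · have hρ : ∀ τ, 3 / 16 < height i (ρ τ) := hρ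
      have hc := fun τ => eq_edge_coord (hρ τ)
      have h0 := hc 0
      have h1 := hc 1
      rw [ρ.source] at h0
      rw [ρ.target] at h1
      exact hseg h0.2.1 h0.2.2 h1.2.1 h1.2.2
        (IsSeg.of_curve (ρ.map (coord i).continuous) ρ fun τ => (hc τ).1)

end Rose

/-! ### Smooth classes -/

namespace Rose

variable {r : ℕ}

open Classical in
/-- The coordinates of a point in the interior of a petal. -/
noncomputable def interiorCoord : Rose r → Option (Fin r × ℝ) :=
  Quot.lift (Sum.elim (fun _ => none)
    fun p => if 0 < (p.2 : ℝ) ∧ (p.2 : ℝ) < 1 then some (p.1, (p.2 : ℝ)) else none) (by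
      rintro _ _ (i | i) <;> simp)

lemma interiorCoord_edge (i : Fin r) {t : ℝ} (h₀ : 0 < t) (h₁ : t < 1) :
    interiorCoord (edge (i, true) t) = some (i, t) := by
  rw [edge_coe (i, true) ⟨t, h₀.le, h₁.le⟩]
  exact if_pos ⟨h₀, h₁⟩

lemma edge_ne_vertex (d : Dir r) {t : ℝ} (h₀ : 0 < t) (h₁ : t < 1) : edge d t ≠ vertex r := by
  intro h
  obtain ⟨i, _ | _⟩ := d
  · rw [show ((i, false) : Dir r) = Dir.bar (i, true) from rfl, edge_bar] at h
    have := interiorCoord_edge i (t := 1 - t) (by linarith) (by linarith)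
    rw [h] at this
    exact absurd this (by exact nofun)
  · have := interiorCoord_edge i h₀ h₁
    rw [h] at this
    exact absurd this (by exact nofun)

/-- `interiorCoord` separates interior points of petals, and with both parameters below `1` the
vertex occurs only at parameter `0`. -/
lemma eq_of_edge_eq_edge {d d' : Dir r} {s s' : ℝ} (h₀ : 0 ≤ s) (h₁ : s < 1) (h₀' : 0 ≤ s')
    (h₁' : s' < 1) (h : edge d s = edge d' s') :
    (s = 0 ∧ s' = 0) ∨ (d' = d ∧ s' = s) ∨ (d' = d.bar ∧ s' = 1 - s) := by
  rcases h₀.eq_or_lt with rfl | h₀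
  · rcases h₀'.eq_or_lt with rfl | h₀'
    · exact Or.inl ⟨rfl, rfl⟩
    · rw [edge_zero] at h
      exact absurd h.symm (edge_ne_vertex d' h₀' h₁')
  rcases h₀'.eq_or_lt with rfl | h₀'
  · rw [edge_zero] at h
    exact absurd h (edge_ne_vertex d h₀ h₁)
  right
  obtain ⟨i, b⟩ := d
  obtain ⟨j, b'⟩ := d'
  have hf : ∀ i : Fin r, ∀ t, edge (i, false) t = edge (i, true) (1 - t) :=
    fun i => edge_bar (i, true)
  have h := congrArg interiorCoord h
  cases b <;> cases b' <;> try simp only [hf] at h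
  all_goals
    rw [interiorCoord_edge _ (by linarith) (by linarith),
      interiorCoord_edge _ (by linarith) (by linarith), Option.some.injEq, Prod.mk.injEq] at h
    obtain ⟨rfl, h⟩ := h
  · exact Or.inl ⟨rfl, by linarith⟩
  · exact Or.inr ⟨rfl, by linarith⟩
  · exact Or.inr ⟨rfl, by linarith⟩
  · exact Or.inl ⟨rfl, by linarith⟩

end Rose

lemma Path.Homotopic.Quotient.map_symm {X Y : Type*} [TopologicalSpace X] [TopologicalSpace Y]
    {x y : X} (α : Homotopic.Quotient x y) (f : C(X, Y)) : α.symm.map f = (α.map f).symm := by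
  induction α using Quotient.ind with | mk a =>
  rw [← mk_symm, ← mk_map, ← mk_map, ← mk_symm, Path.map_symm]

section smoothClasses

variable {r : ℕ} {H : SimpleGraph (Dir r)} {L : List (Fold r)} {ps qs : List (Piece r)}
  {p q m : Rose r}

lemma Traces.cons_inv {a : Piece r} {γ : Homotopic.Quotient p q} (h : Traces (a :: ps) γ) :
    ∃ (m : Rose r) (α : Homotopic.Quotient p m) (β : Homotopic.Quotient m q),
      IsSeg a.d a.s a.t α ∧ Traces ps β ∧ γ = α.trans β := by
  cases h with
  | cons hα hβ => exact ⟨_, _, _, hα, hβ, rfl⟩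

lemma invPieces_getLast? (hs : ∀ a ∈ ps.head?, a.s = 0) :
    ∀ a ∈ (invPieces ps).getLast?, a.t = 1 := by
  cases ps with
  | nil => simp
  | cons a ps => simpa [Piece.bar] using hs

/-- The class of a path made of linked pieces running through a smooth edge path. -/
def IsSmoothClass (H : SimpleGraph (Dir r)) {p q : Rose r} (γ : Homotopic.Quotient p q) : Prop :=
  ∃ ps, Traces ps γ ∧ IsLinked ps ∧ IsSmooth H (word ps)

namespace IsSmoothClass

lemma refl (p : Rose r) : IsSmoothClass H (Homotopic.Quotient.refl p) :=
  ⟨[], Traces.nil p, IsLinked.nil, by simp [IsSmooth]⟩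

lemma symm {γ : Homotopic.Quotient p q} (h : IsSmoothClass H γ) : IsSmoothClass H γ.symm := by
  obtain ⟨ps, h₁, h₂, h₃⟩ := h
  exact ⟨invPieces ps, h₁.inv, h₂.inv, by simpa using h₃.invWord⟩

lemma of_isSeg {d : Dir r} {s t : ℝ} {γ : Homotopic.Quotient p q} (hs₀ : 0 ≤ s) (hs₁ : s ≤ 1)
    (ht₀ : 0 ≤ t) (ht₁ : t ≤ 1) (h : IsSeg d s t γ) : IsSmoothClass H γ := by
  have key : ∀ {d : Dir r} {s t : ℝ}, 0 ≤ s → s < t → t ≤ 1 → IsSeg d s t γ →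
      IsSmoothClass H γ := fun {d s t} h₀ h₁ h₂ h =>
    ⟨[⟨d, s, t⟩], Traces.single h, ⟨by simpa using ⟨h₀, h₁, h₂⟩, by simp⟩, by simp [IsSmooth]⟩
  rcases lt_trichotomy s t with hst | rfl | hst
  · exact key hs₀ hst ht₁ h
  · obtain rfl := h.source
    obtain rfl := h.target
    rw [h.unique (IsSeg.isSeg_refl d s)]
    exact refl _
  · exact key (by linarith) (by linarith) (by linarith) h.bar

lemma map {γ : Homotopic.Quotient p q} (hL : ∀ v, IsSmooth H v → IsSmooth H (wordMap L v))
    (h : IsSmoothClass H γ) : IsSmoothClass H (γ.map (composeMap L)) := by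
  obtain ⟨ps, h₁, h₂, h₃⟩ := h
  exact ⟨piecesMap L ps, h₁.map h₂, isLinked_piecesMap L h₂,
    (hL _ h₃).infix (word_piecesMap_infix L h₂)⟩

/-- Two paths starting at the vertex along a common smooth edge path, after which they take a
smooth turn, differ by a smooth path. -/
lemma symm_trans_of_prefix {A : Homotopic.Quotient p q} {B : Homotopic.Quotient p m}
    {c u v : List (Dir r)} (hA : Traces ps A) (hB : Traces qs B) (hps : IsLinked ps)
    (hqs : IsLinked qs) (hps₀ : ∀ a ∈ ps.head?, a.s = 0) (hqs₀ : ∀ a ∈ qs.head?, a.s = 0)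
    (hu : word ps <+: c ++ u) (hv : word qs <+: c ++ v) (hcu : IsSmooth H (c ++ u))
    (hcv : IsSmooth H (c ++ v)) (huv : IsSmooth H (invWord u ++ v)) :
    IsSmoothClass H (A.symm.trans B) := by
  induction c generalizing ps qs p q m with
  | nil =>
    obtain ⟨u', rfl⟩ := hu
    obtain ⟨v', rfl⟩ := hv
    refine ⟨invPieces ps ++ qs, hA.inv.append hB, hps.inv.append hqs fun a ha b hb =>
      ⟨invPieces_getLast? hps₀ a ha, hqs₀ b hb⟩, huv.infix ⟨invWord u', v', ?_⟩⟩
    simp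
  | cons d c ih =>
    rcases ps with - | ⟨a, ps⟩
    · cases hA
      rw [Homotopic.Quotient.symm_refl, Homotopic.Quotient.refl_trans]
      exact ⟨qs, hB, hqs, hcv.infix hv.isInfix⟩
    rcases qs with - | ⟨b, qs⟩
    · cases hB
      rw [Homotopic.Quotient.trans_refl]
      exact symm ⟨a :: ps, hA, hps, hcu.infix hu.isInfix⟩
    rw [word_cons, List.cons_append, List.cons_prefix_cons] at hu hv
    obtain ⟨had, hu⟩ := hu
    obtain ⟨hbd, hv⟩ := hv
    have has : a.s = 0 := hps₀ a (by simp)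
    have hbs : b.s = 0 := hqs₀ b (by simp)
    have key : ∀ {a b : Piece r} {ps qs : List (Piece r)} {q m : Rose r}
        {A : Homotopic.Quotient p q} {B : Homotopic.Quotient p m}, Traces (a :: ps) A →
        Traces (b :: qs) B → IsLinked (a :: ps) → IsLinked (b :: qs) → a.s = 0 → b.s = 0 →
        a.d = b.d → a.t < b.t → IsSmooth H (word (b :: qs)) →
        IsSmoothClass H (A.symm.trans B) := by
      intro a b ps qs q m A B hA hB hps hqs has hbs hd hab hsm
      -- The shorter piece stops before the end of its edge, hence away from the vertex, so nothing
      -- can follow it.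
      have hps' : ps = [] := by
        cases ps with
        | nil => rfl
        | cons a' ps =>
          have h₁ := (hps.link a' (by simp)).1
          have h₂ := hqs.head.2.2
          linarith
      subst hps'
      obtain ⟨_, α, _, hα, hA', rfl⟩ := hA.cons_inv
      cases hA'
      obtain ⟨_, β, B', hβ, hB', rfl⟩ := hB.cons_inv
      rw [hd] at hα
      obtain rfl := hα.target
      obtain rfl := hβ.target
      obtain ⟨β', hβ'⟩ := IsSeg.exists_isSeg b.d a.t b.t
      rw [has] at hα
      rw [hbs] at hβ
      rw [hβ.unique (hα.trans hβ'), Homotopic.Quotient.trans_refl,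
        Homotopic.Quotient.trans_assoc, ← Homotopic.Quotient.trans_assoc,
        Homotopic.Quotient.symm_trans, Homotopic.Quotient.refl_trans]
      refine ⟨⟨b.d, a.t, b.t⟩ :: qs, .cons hβ' hB', IsLinked.cons ⟨?_, hab, hqs.head.2.2⟩
        hqs.tail hqs.link, hsm⟩
      have := hps.head.2.1
      simp only
      linarith
    rcases lt_trichotomy a.t b.t with hab | hab | hab
    · exact key hA hB hps hqs has hbs (had.trans hbd.symm) hab
        (hcv.infix ((List.cons_prefix_cons.2 ⟨hbd, hv⟩).isInfix))
    · obtain ⟨_, α, A', hα, hA', rfl⟩ := hA.cons_inv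
      obtain ⟨_, β, B', hβ, hB', rfl⟩ := hB.cons_inv
      rw [had, has] at hα
      rw [hbd, hbs, ← hab] at hβ
      obtain rfl := hα.target
      obtain rfl := hβ.target
      rw [hβ.unique hα, Homotopic.Quotient.symm_of_trans, Homotopic.Quotient.trans_assoc,
        ← Homotopic.Quotient.trans_assoc α.symm, Homotopic.Quotient.symm_trans,
        Homotopic.Quotient.refl_trans]
      exact ih hA' hB' hps.tail hqs.tail (fun x hx => (hps.link x hx).2)
        (fun x hx => (hqs.link x hx).2) hu hv hcu.tail hcv.tail
    · have := (key hB hA hqs hps hbs has (hbd.trans had.symm) hab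
        (hcu.infix ((List.cons_prefix_cons.2 ⟨had, hu⟩).isInfix))).symm
      rwa [Homotopic.Quotient.symm_of_trans, Homotopic.Quotient.symm_symm] at this

/-- If the images of smooth paths starting at the vertex tighten to smooth paths, then so do those
of smooth paths with a common initial point at the vertex. -/
lemma map_symm_trans_of_head {A : Homotopic.Quotient p q} {B : Homotopic.Quotient p m}
    (hL : ∀ v, IsSmooth H v → IsSmooth H (wordMap L v))
    (hT : ∀ v v', IsSmooth H v → IsSmooth H v' → TightensTo H L v v')
    (hA : Traces ps A) (hB : Traces qs B) (hps : IsLinked ps) (hqs : IsLinked qs)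
    (hps₀ : ∀ a ∈ ps.head?, a.s = 0) (hqs₀ : ∀ a ∈ qs.head?, a.s = 0)
    (hps' : IsSmooth H (word ps)) (hqs' : IsSmooth H (word qs)) :
    IsSmoothClass H ((A.symm.trans B).map (composeMap L)) := by
  obtain ⟨c, v, w, hv, hw, hvw⟩ := hT _ _ hps' hqs'
  rw [Homotopic.Quotient.map_trans, Homotopic.Quotient.map_symm]
  exact symm_trans_of_prefix (hA.map (L := L) hps) (hB.map (L := L) hqs)
    (isLinked_piecesMap L hps) (isLinked_piecesMap L hqs) (piecesMap_head L hps hps₀)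
    (piecesMap_head L hqs hqs₀) (hv ▸ word_piecesMap_prefix L hps hps₀)
    (hw ▸ word_piecesMap_prefix L hqs hqs₀) (hv ▸ hL _ hps') (hw ▸ hL _ hqs') hvw

/-- Two smooth paths that leave a point in opposite directions form a smooth path. -/
lemma symm_trans_of_bar {a b : Piece r} {A : Homotopic.Quotient p q} {B : Homotopic.Quotient p m}
    (hA : Traces (a :: ps) A) (hB : Traces (b :: qs) B) (hps : IsLinked (a :: ps))
    (hqs : IsLinked (b :: qs)) (hps' : IsSmooth H (word (a :: ps)))
    (hqs' : IsSmooth H (word (b :: qs))) (hd : b.d = a.d.bar) (hs : b.s = 1 - a.s) :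
    IsSmoothClass H (A.symm.trans B) := by
  obtain ⟨_, α, A', hα, hA', rfl⟩ := hA.cons_inv
  obtain ⟨_, β, B', hβ, hB', rfl⟩ := hB.cons_inv
  rw [hd, hs] at hβ
  rw [Homotopic.Quotient.symm_of_trans, Homotopic.Quotient.trans_assoc,
    ← Homotopic.Quotient.trans_assoc α.symm]
  have ha := hps.head
  have hb := hqs.head
  -- The two first pieces lie on one edge and merge into a single piece through their common
  -- starting point, so no new turn is taken.
  refine ⟨invPieces ps ++ ⟨a.d.bar, 1 - a.t, b.t⟩ :: qs,
    hA'.inv.append (.cons (hα.bar_symm.trans hβ) hB'), ?_, ?_⟩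
  · refine hps.tail.inv.append (IsLinked.cons ⟨?_, ?_, hb.2.2⟩ hqs.tail hqs.link) ?_
    · linarith [ha.2.2]
    · simp only
      linarith [ha.2.1, hb.2.1]
    · intro x hx y hy
      obtain rfl : _ = y := by simpa using hy
      refine ⟨invPieces_getLast? (fun c hc => (hps.link c hc).2) x hx, ?_⟩
      cases ps with
      | nil => simp at hx
      | cons c ps => simp [(hps.link c (by simp)).1]
  · have h₁ := hps'.invWord
    rw [word_cons, hd] at hqs'
    rw [word_cons, invWord_cons, ← word_invPieces] at h₁
    have := List.IsChain.append_overlap (l₂ := [a.d.bar]) (l₃ := word qs) h₁ hqs' (by simp)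
    rw [IsSmooth]
    simpa using this

/-- A smooth path starting inside a piece can be extended backwards to the vertex. -/
lemma traces_extend {a : Piece r} {A : Homotopic.Quotient p q} {d : Dir r} {s : ℝ}
    (hA : Traces (a :: ps) A) (hd : a.d = d) (hs : a.s = s)
    {δ : Homotopic.Quotient m p} (hδ : IsSeg d 0 s δ) :
    Traces (⟨a.d, 0, a.t⟩ :: ps) (δ.trans A) := by
  obtain ⟨_, α, A', hα, hA', rfl⟩ := hA.cons_inv
  subst hd hs
  rw [← Homotopic.Quotient.trans_assoc]
  exact .cons (hδ.trans hα) hA'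

/-- The image of the product of two smooth classes is smooth. -/
lemma map_trans {α : Homotopic.Quotient p q} {β : Homotopic.Quotient q m}
    (hL : ∀ v, IsSmooth H v → IsSmooth H (wordMap L v))
    (hT : ∀ v v', IsSmooth H v → IsSmooth H v' → TightensTo H L v v')
    (hα : IsSmoothClass H α) (hβ : IsSmoothClass H β) :
    IsSmoothClass H ((α.trans β).map (composeMap L)) := by
  -- Reversing `α` makes both paths start at the common point `q`, so their first pieces can be
  -- compared.
  obtain ⟨ps, hA, hps, hps'⟩ := hα.symm
  obtain ⟨qs, hB, hqs, hqs'⟩ := id hβ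
  rw [← Homotopic.Quotient.symm_symm α]
  rw [← Homotopic.Quotient.symm_symm α] at hα
  generalize α.symm = A at hA hα
  rcases ps with - | ⟨a, ps⟩
  · cases hA
    rw [Homotopic.Quotient.symm_refl, Homotopic.Quotient.refl_trans]
    exact hβ.map hL
  rcases qs with - | ⟨b, qs⟩
  · cases hB
    rw [Homotopic.Quotient.trans_refl]
    exact hα.map hL
  have hq : q = Rose.edge a.d a.s := by
    obtain ⟨_, α, A', hα, -⟩ := hA.cons_inv
    exact hα.source
  have hq' : q = Rose.edge b.d b.s := by
    obtain ⟨_, α, A', hα, -⟩ := hB.cons_inv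
    exact hα.source
  obtain ⟨ha₀, ha₁, ha₂⟩ := hps.head
  obtain ⟨hb₀, hb₁, hb₂⟩ := hqs.head
  rcases Rose.eq_of_edge_eq_edge ha₀ (by linarith) hb₀ (by linarith) (hq.symm.trans hq') with
    ⟨hs, hs'⟩ | ⟨hd, hs⟩ | ⟨hd, hs⟩
  · exact map_symm_trans_of_head hL hT hA hB hps hqs (by simpa using hs) (by simpa using hs')
      hps' hqs'
  · subst hq
    obtain ⟨δ, hδ⟩ := IsSeg.exists_isSeg a.d 0 a.s
    -- Both paths leave an interior point in the same direction. Extending both back to the vertex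
    -- by the same segment reduces to the vertex case, since the extension cancels in the product.
    have key := map_symm_trans_of_head hL hT (traces_extend hA rfl rfl hδ)
      (traces_extend hB hd hs hδ)
      (IsLinked.cons ⟨le_rfl, by simp only; linarith, ha₂⟩ hps.tail hps.link)
      (IsLinked.cons ⟨le_rfl, by simp only; linarith, hb₂⟩ hqs.tail hqs.link)
      (by simp) (by simp) hps' hqs'
    rwa [Homotopic.Quotient.symm_of_trans, Homotopic.Quotient.trans_assoc,
      ← Homotopic.Quotient.trans_assoc δ.symm, Homotopic.Quotient.symm_trans,
      Homotopic.Quotient.refl_trans] at key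
  · exact (symm_trans_of_bar hA hB hps hqs hps' hqs' hd hs).map hL

end IsSmoothClass

end smoothClasses

/-! ### Absence of periodic Nielsen paths -/

section periodic

variable {X : Type*} [TopologicalSpace X] {S T : ∀ {p q : X}, Homotopic.Quotient p q → Prop}
  {f : C(X, X)}

lemma Path.Homotopic.Quotient.iterate_of_map
    (h : ∀ {p q : X} {γ : Homotopic.Quotient p q}, S γ → S (γ.map f)) (k : ℕ) {p q : X}
    (ρ : Path p q) (hρ : S (mk ρ)) : S (mk (ρ.map (f.continuous.iterate k))) := by
  induction k generalizing p q with
  | zero => exact hρ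
  | succ k ih => exact ih (ρ.map f.continuous) (h hρ)

/-- If every class with the property `S` is mapped to a class with the property `T`, and this
property is preserved, then a periodic class with the property `S` has the property `T`. -/
lemma Path.Homotopic.Quotient.of_periodic
    (hS : ∀ {p q : X} {γ : Homotopic.Quotient p q}, S γ → T (γ.map f))
    (hT : ∀ {p q : X} {γ : Homotopic.Quotient p q}, T γ → T (γ.map f)) {k : ℕ} (hk : 0 < k)
    {p q : X} {ρ : Path p q} {hp : p = f^[k] p} {hq : q = f^[k] q}
    (h : ((ρ.map (f.continuous.iterate k)).cast hp hq).Homotopic ρ) (hρ : S (mk ρ)) :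
    T (mk ρ) := by
  obtain ⟨k, rfl⟩ := Nat.exists_eq_succ_of_ne_zero hk.ne'
  have hcast : ∀ {p p' q q' : X} (hp : p = p') (hq : q = q') (ρ : Path p' q'), T (mk ρ) →
      T (mk (ρ.cast hp hq)) := by
    intro p p' q q' hp hq ρ h
    subst hp hq
    exact h
  rw [← Homotopic.Quotient.eq.2 h]
  have hρ' : T ((mk ρ).map f) := hS hρ
  exact hcast _ _ _ (iterate_of_map (S := fun {p q} γ => T γ) hT k (ρ.map f.continuous) hρ')

end periodic

section smoothProducts

variable {r : ℕ} {H : SimpleGraph (Dir r)} {L : List (Fold r)} {p q m : Rose r}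

/-- The class is a product of `n + 1` smooth classes. -/
inductive IsSmoothProduct (H : SimpleGraph (Dir r)) :
    ℕ → ∀ {p q : Rose r}, Homotopic.Quotient p q → Prop
  | single {p q : Rose r} {γ : Homotopic.Quotient p q} (h : IsSmoothClass H γ) :
      IsSmoothProduct H 0 γ
  | cons {n : ℕ} {p q m : Rose r} {α : Homotopic.Quotient p q} {β : Homotopic.Quotient q m}
      (hα : IsSmoothClass H α) (hβ : IsSmoothProduct H n β) : IsSmoothProduct H (n + 1) (α.trans β)

namespace IsSmoothProduct

lemma trans {a b : ℕ} {α : Homotopic.Quotient p q} {β : Homotopic.Quotient q m}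
    (hα : IsSmoothProduct H a α) (hβ : IsSmoothProduct H b β) :
    ∃ n, IsSmoothProduct H n (α.trans β) := by
  induction hα with
  | single h => exact ⟨_, .cons h hβ⟩
  | cons h _ ih =>
    obtain ⟨n, hn⟩ := ih hβ
    rw [Homotopic.Quotient.trans_assoc]
    exact ⟨_, .cons h hn⟩

lemma exists_isSmoothProduct (γ : Homotopic.Quotient p q) : ∃ n, IsSmoothProduct H n γ := by
  refine Rose.induction_of_isSeg (S := fun {p q} γ => ∃ n, IsSmoothProduct H n γ) ?_ ?_ ?_ γ
  · exact fun p => ⟨0, .single (.refl p)⟩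
  · exact fun hs₀ hs₁ ht₀ ht₁ h => ⟨0, .single (.of_isSeg hs₀ hs₁ ht₀ ht₁ h)⟩
  · rintro p q m α β ⟨a, ha⟩ ⟨b, hb⟩
    exact ha.trans hb

lemma map (hL : ∀ v, IsSmooth H v → IsSmooth H (wordMap L v)) {n : ℕ}
    {γ : Homotopic.Quotient p q} (h : IsSmoothProduct H n γ) :
    IsSmoothProduct H n (γ.map (composeMap L)) := by
  induction h with
  | single h => exact .single (h.map hL)
  | cons h _ ih =>
    rw [Homotopic.Quotient.map_trans]
    exact .cons (h.map hL) ih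

/-- One application of the map merges the last two factors and keeps all the others smooth. -/
lemma map_succ (hL : ∀ v, IsSmooth H v → IsSmooth H (wordMap L v))
    (hT : ∀ v v', IsSmooth H v → IsSmooth H v' → TightensTo H L v v') {n : ℕ}
    {γ : Homotopic.Quotient p q} (h : IsSmoothProduct H (n + 1) γ) :
    IsSmoothProduct H n (γ.map (composeMap L)) := by
  induction n generalizing p q with
  | zero =>
    cases h with
    | cons hα hβ =>
      cases hβ with
      | single hβ => exact .single (hα.map_trans hL hT hβ)
  | succ n ih =>
    cases h with
    | cons hα hβ =>
      rw [Homotopic.Quotient.map_trans]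
      exact .cons (hα.map hL) (ih hβ)

end IsSmoothProduct

/-- The class is that of a path made of linked pieces running through a smooth edge path, of length
at least `B`. -/
def IsLongSmooth (H : SimpleGraph (Dir r)) (B : ℝ) {p q : Rose r} (γ : Homotopic.Quotient p q) :
    Prop :=
  ∃ ps, Traces ps γ ∧ IsLinked ps ∧ IsSmooth H (word ps) ∧ B ≤ totalLength ps

lemma IsLongSmooth.map {B : ℝ} {γ : Homotopic.Quotient p q}
    (hL : ∀ v, IsSmooth H v → IsSmooth H (wordMap L v)) (h : IsLongSmooth H B γ) :
    IsLongSmooth H B (γ.map (composeMap L)) := by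
  obtain ⟨ps, h₁, h₂, h₃, h₄⟩ := h
  exact ⟨piecesMap L ps, h₁.map h₂, isLinked_piecesMap L h₂,
    (hL _ h₃).infix (word_piecesMap_infix L h₂), h₄.trans (totalLength_le_piecesMap L h₂.1)⟩

lemma IsLongSmooth.map_two_mul {B : ℝ} {γ : Homotopic.Quotient p q}
    (hL : ∀ v, IsSmooth H v → IsSmooth H (wordMap L v)) (hfold : ∀ i, ∃ g ∈ L, g.u.1 = i)
    (h : IsLongSmooth H B γ) : IsLongSmooth H (2 * B) (γ.map (composeMap L)) := by
  obtain ⟨ps, h₁, h₂, h₃, h₄⟩ := h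
  exact ⟨piecesMap L ps, h₁.map h₂, isLinked_piecesMap L h₂,
    (hL _ h₃).infix (word_piecesMap_infix L h₂),
    (mul_le_mul_of_nonneg_left h₄ zero_le_two).trans (two_mul_le_totalLength h₂.1 hfold)⟩

/-- If `H`-smooth edge paths are mapped to such paths, the images of any two of them tighten to an
`H`-smooth path, and every edge gets folded, then there are no periodic Nielsen paths. -/
theorem not_hasPeriodicNielsenPath (hL : ∀ v, IsSmooth H v → IsSmooth H (wordMap L v))
    (hT : ∀ v v', IsSmooth H v → IsSmooth H v' → TightensTo H L v v')
    (hfold : ∀ i, ∃ g ∈ L, g.u.1 = i) : ¬ HasPeriodicNielsenPath (composeMap L) := by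
  rintro ⟨k, p, q, ρ, hk, hne, hp, hq, h⟩
  -- Each use of periodicity removes one factor, until a single smooth class is left.
  have hsmooth : IsSmoothProduct H 0 (Homotopic.Quotient.mk ρ) := by
    obtain ⟨n, hn⟩ := IsSmoothProduct.exists_isSmoothProduct (H := H) (Homotopic.Quotient.mk ρ)
    induction n with
    | zero => exact hn
    | succ n ih =>
      exact ih (Homotopic.Quotient.of_periodic (S := fun {p q} γ => IsSmoothProduct H (n + 1) γ)
        (T := fun {p q} γ => IsSmoothProduct H n γ) (fun h => h.map_succ hL hT)
        (fun h => h.map hL) hk h hn)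
  cases hsmooth with | single hsmooth =>
  obtain ⟨ps, h₁, h₂, h₃⟩ := hsmooth
  rcases ps with - | ⟨a, ps⟩
  · refine hne ?_
    generalize hγ : Homotopic.Quotient.mk ρ = γ at h₁
    cases h₁
    exact ⟨rfl, Homotopic.Quotient.eq.1 hγ⟩
  have hpos : 0 < totalLength (a :: ps) := by
    rw [totalLength_cons]
    have h₄ : 0 ≤ totalLength ps := by
      refine List.sum_nonneg fun x hx => ?_
      obtain ⟨b, hb, rfl⟩ := List.mem_map.1 hx
      exact sub_nonneg.2 (h₂.tail.1 b hb).2.1.le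
    linarith [h₂.head.2.1]
  -- Periodicity returns the same class while one application doubles the guaranteed length, so the
  -- class has arbitrarily long smooth representatives.
  have hlong : ∀ n : ℕ, IsLongSmooth H (2 ^ n * totalLength (a :: ps))
      (Homotopic.Quotient.mk ρ) := by
    intro n
    induction n with
    | zero => exact ⟨_, h₁, h₂, h₃, by simp⟩
    | succ n ih =>
      rw [pow_succ', mul_assoc]
      exact Homotopic.Quotient.of_periodic (S := fun {p q} γ => IsLongSmooth H _ γ)
        (T := fun {p q} γ => IsLongSmooth H _ γ) (fun h => h.map_two_mul hL hfold)
        (fun h => h.map hL) hk h ih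
  obtain ⟨N, hN⟩ := exists_length_le (Homotopic.Quotient.mk ρ)
  obtain ⟨n, hn⟩ := pow_unbounded_of_one_lt (N / totalLength (a :: ps)) one_lt_two
  obtain ⟨qs, k₁, k₂, k₃, k₄⟩ := hlong n
  -- Smooth words are reduced because the graph of turns has no loops.
  have hqs : qs.length ≤ N := hN qs k₁ k₂ (k₃.imp fun e e' h h' => h.ne' h')
  have hqs' : (qs.length : ℝ) ≤ N := Nat.cast_le.2 hqs
  have := IsLinked.totalLength_le k₂.1
  rw [div_lt_iff₀ hpos] at hn
  linarith

end smoothProducts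

/-! ### The prevention sequence -/

section prevention

variable {r : ℕ}

lemma composeEdgeMap_transitionMatrix_eq_zero {L : List (Fold r)} {i j : Fin r}
    (h : ∀ g ∈ L, g.u.1 ≠ i) (hij : j ≠ i) : (composeEdgeMap L).transitionMatrix j i = 0 := by
  rw [EdgeMap.transitionMatrix, composeEdgeMap_eq_singleton _ h (d := (i, true)) rfl]
  simp [hij.symm]

/-- If the transition matrix is irreducible, then every edge gets folded. -/
lemma exists_fold_of_isIrreducible [Nontrivial (Fin r)] {L : List (Fold r)}
    (h : (composeEdgeMap L).transitionMatrix.IsIrreducible) (i : Fin r) :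
    ∃ g ∈ L, g.u.1 = i := by
  by_contra! hL
  obtain ⟨j, hj⟩ := exists_ne i
  let := Matrix.toQuiver (composeEdgeMap L).transitionMatrix
  -- An unfolded petal `i` is mapped to itself alone, so no entry of the matrix leads from another
  -- index to `i`, and `i` cannot be reached from `j`.
  have key : ∀ {k : Fin r}, Quiver.Path j k → k ≠ i := by
    intro k p
    induction p with
    | nil => exact hj
    | cons p e ih =>
      rintro rfl
      have := e.down
      rw [composeEdgeMap_transitionMatrix_eq_zero hL ih] at this
      exact absurd this (lt_irrefl _)
  obtain ⟨p, -⟩ := h.connected j i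
  exact key p rfl

lemma LTT.eq_complete_colored {G : SimpleGraph (Dir r)} {u v : Dir r} {τ : Equiv.Perm (Dir r)}
    (h : ∀ d d', (LTT.complete u v).colored.Adj d d' ↔ G.Adj (τ d) (τ d')) :
    G = (LTT.complete (τ u) (τ v)).colored := by
  ext a b
  obtain ⟨a, rfl⟩ := τ.surjective a
  obtain ⟨b, rfl⟩ := τ.surjective b
  rw [← h]
  simp [LTT.complete, τ.injective.eq_iff]

/-- Rotating `P ++ Q` by the length of `P` gives `Q ++ P`, so `IsSmooth.wordMap` applies with both
structures known to be complete ones. -/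
lemma IsSmooth.wordMap_of_associatedLTT {P Q : List (Fold r)}
    (hL : (composeEdgeMap (P ++ Q)).IsTrainTrack) {u v x y : Dir r}
    (hG : (associatedLTT (P ++ Q) P.length).colored = (LTT.complete u v).colored)
    (hG₀ : (associatedLTT (P ++ Q) 0).colored = (LTT.complete x y).colored) (e : List (Dir r))
    (he : IsSmooth (LTT.complete u v).colored e) :
    IsSmooth (LTT.complete x y).colored (_root_.wordMap Q e) := by
  rw [← hG, associatedLTT, List.rotate_append_length_eq] at he
  rw [← hG₀, associatedLTT, List.rotate_zero]
  exact he.wordMap hL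

theorem not_hasPeriodicNielsenPath_of_associatedLTT {x y z w : Dir r} (hxy : x.1 ≠ y.1)
    (hxz : x.1 ≠ z.1) (hxw : x.1 ≠ w.1) (hyz : y.1 ≠ z.1) (hyw : y.1 ≠ w.1) (hzw : z.1 ≠ w.1)
    {g₁ g₂ g₃ g₄ g₅ : Fold r} {M : List (Fold r)}
    (hg₁ : g₁ = ⟨z, x, hxz⟩) (hg₂ : g₂ = ⟨w, z, hzw⟩) (hg₃ : g₃ = ⟨y.bar, w, hyw.symm⟩)
    (hg₄ : g₄ = ⟨y.bar, x, hxy⟩) (hg₅ : g₅ = ⟨y.bar, w, hyw.symm⟩)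
    (hL : (composeEdgeMap (g₁ :: g₂ :: g₃ :: g₄ :: g₅ :: M)).IsTrainTrack)
    (hA : (composeEdgeMap (g₁ :: g₂ :: g₃ :: g₄ :: g₅ :: M)).transitionMatrix.IsIrreducible)
    (h₀ : (associatedLTT (g₁ :: g₂ :: g₃ :: g₄ :: g₅ :: M) 0).colored = (LTT.complete x y).colored)
    (h₁ : (associatedLTT (g₁ :: g₂ :: g₃ :: g₄ :: g₅ :: M) 1).colored =
      (LTT.complete z x.bar).colored)
    (h₂ : (associatedLTT (g₁ :: g₂ :: g₃ :: g₄ :: g₅ :: M) 2).colored =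
      (LTT.complete w z.bar).colored)
    (h₃ : (associatedLTT (g₁ :: g₂ :: g₃ :: g₄ :: g₅ :: M) 3).colored =
      (LTT.complete y.bar w.bar).colored)
    (h₄ : (associatedLTT (g₁ :: g₂ :: g₃ :: g₄ :: g₅ :: M) 4).colored =
      (LTT.complete y.bar x.bar).colored)
    (h₅ : (associatedLTT (g₁ :: g₂ :: g₃ :: g₄ :: g₅ :: M) 5).colored =
      (LTT.complete y.bar w.bar).colored) :
    ¬ HasPeriodicNielsenPath (composeMap (g₁ :: g₂ :: g₃ :: g₄ :: g₅ :: M)) := by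
  have : Nontrivial (Fin r) := ⟨x.1, y.1, hxy⟩
  have k₀ := IsSmooth.wordMap_of_associatedLTT (P := []) hL h₀ h₀
  exact not_hasPeriodicNielsenPath k₀
    (tightensTo_of_isSmooth hxy hxz hxw hyz hyw hzw hg₁ hg₂ hg₃ hg₄ hg₅ k₀
      (IsSmooth.wordMap_of_associatedLTT (P := [g₁]) hL h₁ h₀)
      (IsSmooth.wordMap_of_associatedLTT (P := [g₁, g₂]) hL h₂ h₀)
      (IsSmooth.wordMap_of_associatedLTT (P := [g₁, g₂, g₃]) hL h₃ h₀)
      (IsSmooth.wordMap_of_associatedLTT (P := [g₁, g₂, g₃, g₄]) hL h₄ h₀)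
      (IsSmooth.wordMap_of_associatedLTT (P := [g₁, g₂, g₃, g₄, g₅]) hL h₅ h₀))
    (exists_fold_of_isIrreducible hA)

lemma Dir.fst_ne_of_comm_bar {τ : Equiv.Perm (Dir r)} (hτ : ∀ d, τ d.bar = (τ d).bar) {d e : Dir r}
    (h : d.1 ≠ e.1) : (τ d).1 ≠ (τ e).1 := by
  intro h'
  rcases Dir.eq_or_eq_bar h' with h' | h'
  · exact h (congrArg Prod.fst (τ.injective h'))
  · rw [← hτ] at h'
    obtain rfl := τ.injective h'
    exact h rfl

end prevention

theorem mainTheorem4 {r : ℕ} (x y z w : Dir r)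
    (hxy : x.1 ≠ y.1) (hxz : x.1 ≠ z.1) (hxw : x.1 ≠ w.1)
    (hyz : y.1 ≠ z.1) (hyw : y.1 ≠ w.1) (hzw : z.1 ≠ w.1) :
    IsNielsenPathPreventionSequence
      ![(⟨z, x, hxz⟩ : Fold r), ⟨w, z, hzw⟩, ⟨y.bar, w, hyw.symm⟩, ⟨y.bar, x, hxy⟩,
        ⟨y.bar, w, hyw.symm⟩, ⟨y.bar, x, hxy⟩]
      ![LTT.complete x y, LTT.complete z x.bar, LTT.complete w z.bar,
        LTT.complete y.bar w.bar, LTT.complete y.bar x.bar,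
        LTT.complete y.bar w.bar, LTT.complete y.bar x.bar] := by
  have hne : ∀ {d e : Dir r}, d.1 ≠ e.1 → d ≠ e := Dir.ne_of_fst_ne
  refine ⟨⟨?_, ?_, ?_⟩, ?_⟩
  · intro i
    fin_cases i
    · exact LTT.isType_complete (hne hxy)
    · exact LTT.isType_complete (hne hxz.symm)
    · exact LTT.isType_complete (hne hzw.symm)
    · exact LTT.isType_complete (hne hyw)
    · exact LTT.isType_complete (hne hxy.symm)
    · exact LTT.isType_complete (hne hyw)
    · exact LTT.isType_complete (hne hxy.symm)
  · intro i
    fin_cases i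
    · exact Or.inr (isSwitch_complete ⟨z, x, hxz⟩ (hne hxy.symm) (hne hyz))
    · exact Or.inr (isSwitch_complete ⟨w, z, hzw⟩ (hne hxz) (hne hxw))
    · exact Or.inr (isSwitch_complete ⟨y.bar, w, hyw.symm⟩ (hne hzw) (hne hyz.symm))
    · exact Or.inl (isExtension_complete ⟨y.bar, x, hxy⟩ (hne hxw.symm) (hne hyw.symm))
    · exact Or.inl (isExtension_complete ⟨y.bar, w, hyw.symm⟩ (hne hxw) (hne hxy))
    · exact Or.inl (isExtension_complete ⟨y.bar, x, hxy⟩ (hne hxw.symm) (hne hyw.symm))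
  · intro i
    fin_cases i
    · exact LTT.isAdmissible_complete hxy hxy hxz hyz
    · exact LTT.isAdmissible_complete hxz.symm hxy hxz hyz
    · exact LTT.isAdmissible_complete hzw.symm hxy hxz hyz
    · exact LTT.isAdmissible_complete hyw hxy hxz hyz
    · exact LTT.isAdmissible_complete hxy.symm hxy hxz hyz
    · exact LTT.isAdmissible_complete hyw hxy hxz hyz
    · exact LTT.isAdmissible_complete hxy.symm hxy hxz hyz
  · intro m g' hL hA τ hτ htriple
    -- A relabeling compatible with reversal sends distinct petals to distinct petals, so the images
    -- of `x`, `y`, `z`, `w` satisfy the same hypotheses and the relabeling is absorbed.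
    have hfst : ∀ {d e : Dir r}, d.1 ≠ e.1 → (τ d).1 ≠ (τ e).1 :=
      fun h => Dir.fst_ne_of_comm_bar hτ h
    have t₀ := htriple 0
    have t₁ := htriple 1
    have t₂ := htriple 2
    have t₃ := htriple 3
    have t₄ := htriple 4
    have t₅ := htriple 5
    have hget : ∀ i : Fin 6, (List.ofFn g')[(i : ℕ)]? = some (g' (Fin.castAdd m i)) := by
      intro i
      have hi : (i : ℕ) < 6 + m := by omega
      rw [List.getElem?_ofFn, dif_pos hi]
      rfl
    have e₀ := hget 0
    have e₁ := hget 1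
    have e₂ := hget 2
    have e₃ := hget 3
    have e₄ := hget 4
    have hlen : (List.ofFn g').length = 6 + m := List.length_ofFn
    have hL := hL.trainTrack
    generalize List.ofFn g' = L at *
    -- Only the first five folds enter the cancellation argument; the sixth and all later ones stay
    -- in `M`.
    obtain _ | ⟨g₁, _ | ⟨g₂, _ | ⟨g₃, _ | ⟨g₄, _ | ⟨g₅, M⟩⟩⟩⟩⟩ := L
    iterate 5
      simp only [List.length_nil, List.length_cons] at hlen
      omega
    obtain rfl := Option.some.inj e₀
    obtain rfl := Option.some.inj e₁
    obtain rfl := Option.some.inj e₂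
    obtain rfl := Option.some.inj e₃
    obtain rfl := Option.some.inj e₄
    have hbar : ∀ {G : SimpleGraph (Dir r)} {u v : Dir r},
        G = (LTT.complete (τ u) (τ v.bar)).colored → G = (LTT.complete (τ u) (τ v).bar).colored :=
      fun h => hτ _ ▸ h
    have hbar' : ∀ {G : SimpleGraph (Dir r)} {u v : Dir r},
        G = (LTT.complete (τ u.bar) (τ v.bar)).colored →
          G = (LTT.complete (τ u).bar (τ v).bar).colored :=
      fun h => hτ _ ▸ hτ _ ▸ h
    exact not_hasPeriodicNielsenPath_of_associatedLTT (hfst hxy) (hfst hxz) (hfst hxw) (hfst hyz)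
      (hfst hyw) (hfst hzw) (Fold.ext t₀.1.1 t₀.1.2) (Fold.ext t₁.1.1 t₁.1.2)
      (Fold.ext (t₂.1.1.trans (hτ y)) t₂.1.2) (Fold.ext (t₃.1.1.trans (hτ y)) t₃.1.2)
      (Fold.ext (t₄.1.1.trans (hτ y)) t₄.1.2) hL hA
      (LTT.eq_complete_colored t₀.2.1.2) (hbar (LTT.eq_complete_colored t₁.2.1.2))
      (hbar (LTT.eq_complete_colored t₂.2.1.2)) (hbar' (LTT.eq_complete_colored t₃.2.1.2))
      (hbar' (LTT.eq_complete_colored t₄.2.1.2)) (hbar' (LTT.eq_complete_colored t₅.2.1.2))
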